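/- Let $f:\mathbb{R}^n\to\mathbb{R}^n$ and $g:\mathbb{R}^n\to\mathbb{R}^{n\times m}$ be of class $C^1$ with $f(0)=0$, and consider the system $\dot x=f(x)+g(x)u$. The origin of $\dot z=F(z)$ is called locally exponentially stable (LES) if there are constants $c,k,\lambda>0$ such that for every $\|z_0\|<c$ the solution with $z(0)=z_0$ exists on $[0,\infty)$ and satisfies $\|z(t)\|\le k\|z_0\|e^{-\lambda t}$ for all $t\ge 0$. Assume that there is a $C^1$ map $\kappa:\mathbb{R}^n\to\mathbb{R}^m$ with $\kappa(0)=0$ such that the origin of $\dot x=f(x)+g(x)\kappa(x)$ is LES. Consider policies of the form $$Q:\quad \dot{\hat x}=f(x)-s(x-\hat x)+g(x)u,\qquad \dot q=f_q(q,\hat x,x),\qquad u=K\hat x+h_q(q,\hat x,x),$$ with $\hat x\in\mathbb{R}^n$, $q\in\mathbb{R}^{n_q}$ ($n_q\ge 0$), $K\in\mathbb{R}^{m\times n}$, $s:\mathbb{R}^n\to\mathbb{R}^n$, and $f_q:\mathbb{R}^{n_q}\times\mathbb{R}^n\times\mathbb{R}^n\to\mathbb{R}^{n_q}$, $h_q:\mathbb{R}^{n_q}\times\mathbb{R}^n\times\mathbb{R}^n\to\mathbb{R}^m$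 of class $C^1$, and the conditions (i) $\frac{\partial f}{\partial x}(0)+g(0)K$ is Hurwitz (all its eigenvalues have negative real part); (ii) $s$ is of class $C^1$ and the origin of $\dot\zeta=s(\zeta)$ is LES; (iii) the origin of $\dot q=f_q(q,0,0)$ is LES; (iv) $f_q(q,y,y)=f_q(q,0,0)$ and $h_q(q,y,y)=h_q(q,0,0)$ for all $q\in\mathbb{R}^{n_q}$, $y\in\mathbb{R}^n$, and $h_q(0,0,0)=0$. (Sufficiency) If $Q$ satisfies (i)–(iv), then the origin $(x,\hat x,q)=(0,0,0)$ of the closed loop of the system with $Q$ is LES. (Necessity) Let $C$ be a controller $\dot x_c=f_c(x_c,x)$, $u=h_c(x_c,x)$ with $x_c\in\mathbb{R}^{n_c}$ ($n_c\ge0$), $f_c:\mathbb{R}^{n_c}\times\mathbb{R}^n\to\mathbb{R}^{n_c}$ and $h_c:\mathbb{R}^{n_c}\times\mathbb{R}^n\to\mathbb{R}^m$ of class $C^1$, $f_c(0,0)=0$ and $h_c(0,0)=0$, such that the origin $(x_c,x)=(0,0)$ of the closed loop of the system with $C$ is LES. Then $C$ can be rewritten as a policy $Q$ of the above form satisfying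 (i)–(iv): there is such a $Q$ with the property that for every initial state $x_c(0)$ of $C$ there is an initial state $(\hat x(0),q(0))$ of $Q$ such that, for every continuous state signal $x(\cdot)$ on a time interval starting at $0$, $C$ and $Q$ with these initial states generate the same control signals $u(\cdot)$; that is, $u(\cdot)$ is an output of $C$ on this interval if and only if it is an output of $Q$. In particular, the closed loops with $C$ and with $Q$ have the same trajectories $(x(\cdot),u(\cdot))$ from every $x(0)$. -/

import Mathlib

/-- Euclidean space `ℝⁿ`. -/
abbrev Vec (n : ℕ) : Type := EuclideanSpace ℝ (Fin n)

/-- The product of a matrix with a (Euclidean) vector. -/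
noncomputable def matVec {k l : ℕ} (A : Matrix (Fin k) (Fin l) ℝ) (v : Vec l) : Vec k :=
  Matrix.toEuclideanLin A v

/-- The Jacobian matrix `∂F/∂x` at the point `a`. -/
noncomputable def jacobianMatrix {k l : ℕ} (F : Vec l → Vec k) (a : Vec l) :
    Matrix (Fin k) (Fin l) ℝ :=
  Matrix.of fun i j => (fderiv ℝ F a (EuclideanSpace.single j 1)) i

/-- A real square matrix is Hurwitz if all its complex eigenvalues have negative real part. -/
def IsHurwitz {n : ℕ} (A : Matrix (Fin n) (Fin n) ℝ) : Prop :=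
  ∀ z ∈ spectrum ℂ (A.map (algebraMap ℝ ℂ)), z.re < 0

section Stability

variable {E : Type*} [NormedAddCommGroup E] [NormedSpace ℝ E]

/-- `x` solves `ẋ = F(x)` on `[0, ∞)` (with the one-sided derivative at `0`). -/
def IsForwardSolution (F : E → E) (x : ℝ → E) : Prop :=
  ∀ t : ℝ, 0 ≤ t → HasDerivWithinAt x (F (x t)) (Set.Ici 0) t

/-- The origin is locally exponentially stable for `ẋ = F(x)`: from every initial state of norm
less than `c` there is a solution on `[0, ∞)`, and every such solution satisfies
`‖x(t)‖ ≤ k ‖x(0)‖ exp(-r t)`. Taking `x(0) = 0`, this forces `F 0 = 0`. The notion does not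
change when the norm is replaced by an equivalent one (such as the maximum norm on products). -/
def LocallyExpStable (F : E → E) : Prop :=
  ∃ c > (0 : ℝ), ∃ k > (0 : ℝ), ∃ r > (0 : ℝ), ∀ x₀ : E, ‖x₀‖ < c →
    (∃ x : ℝ → E, x 0 = x₀ ∧ IsForwardSolution F x) ∧
    ∀ x : ℝ → E, x 0 = x₀ → IsForwardSolution F x →
      ∀ t : ℝ, 0 ≤ t → ‖x t‖ ≤ k * ‖x₀‖ * Real.exp (-r * t)

end Stability

/-- The pair `(f, g)` is exponentially stabilizable by a static `C¹` state feedback. -/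
def ExpStabilizable {n m : ℕ} (f : Vec n → Vec n) (g : Vec n → Matrix (Fin n) (Fin m) ℝ) : Prop :=
  ∃ κ : Vec n → Vec m, ContDiff ℝ 1 κ ∧ κ 0 = 0 ∧
    LocallyExpStable fun x => f x + matVec (g x) (κ x)

/-- A state-feedback policy `ż = dyn(z, x)`, `u = out(z, x)` with internal state `z ∈ Z`. -/
structure Policy (n m : ℕ) (Z : Type) where
  dyn : Z → Vec n → Z
  out : Z → Vec n → Vec m

/-- The vector field of the plant `ẋ = f(x) + g(x) u` in closed loop with a policy, in the
state `(x, z)`. -/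
noncomputable def closedLoop {n m : ℕ} {Z : Type} (f : Vec n → Vec n)
    (g : Vec n → Matrix (Fin n) (Fin m) ℝ) (P : Policy n m Z) : Vec n × Z → Vec n × Z :=
  fun w => (f w.1 + matVec (g w.1) (P.out w.2 w.1), P.dyn w.2 w.1)

/-- On the time interval `J`, the policy `P` started at `z₀` answers the plant-state signal `x`
with the control signal `u`. -/
def IsResponse {n m : ℕ} {Z : Type} [NormedAddCommGroup Z] [NormedSpace ℝ Z] (P : Policy n m Z)
    (z₀ : Z) (J : Set ℝ) (x : ℝ → Vec n) (u : ℝ → Vec m) : Prop :=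
  ∃ z : ℝ → Z, z 0 = z₀ ∧
    ∀ t ∈ J, HasDerivWithinAt z (P.dyn (z t) (x t)) J t ∧ u t = P.out (z t) (x t)

/-- The policy `P` can be rewritten as the policy `P'`: to every initial state of `P` there is an
initial state of `P'` (depending on nothing else) such that, on every time interval
starting at `0` and for every continuous plant-state signal `x`, the two policies produce the same
control signals. Since this holds for every signal `x`, it holds in particular in closed loop with
any plant. -/
def RewritesAs {n m : ℕ} {Z Z' : Type} [NormedAddCommGroup Z] [NormedSpace ℝ Z]
    [NormedAddCommGroup Z'] [NormedSpace ℝ Z'] (P : Policy n m Z) (P' : Policy n m Z') : Prop :=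
  ∀ z₀ : Z, ∃ z₀' : Z', ∀ J : Set ℝ, J.OrdConnected → 0 ∈ J → J ⊆ Set.Ici 0 →
    ∀ x : ℝ → Vec n, ContinuousOn x J → ∀ u : ℝ → Vec m,
      IsResponse P z₀ J x u ↔ IsResponse P' z₀' J x u

/-- A dynamic state-feedback controller `ẋ_c = f_c(x_c, x)`, `u = h_c(x_c, x)` of class `C¹`
with `f_c(0, 0) = 0` and `h_c(0, 0) = 0`. For `nc = 0` it is a static feedback. -/
structure DynController (n m nc : ℕ) where
  fc : Vec nc × Vec n → Vec nc
  hc : Vec nc × Vec n → Vec m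
  contDiff_fc : ContDiff ℝ 1 fc
  contDiff_hc : ContDiff ℝ 1 hc
  fc_zero : fc (0, 0) = 0
  hc_zero : hc (0, 0) = 0

/-- A dynamic controller as a policy. -/
def DynController.toPolicy {n m nc : ℕ} (C : DynController n m nc) : Policy n m (Vec nc) where
  dyn z x := C.fc (z, x)
  out z x := C.hc (z, x)

/-- The parameters of an observer-plus-Youla policy; arguments of `fq` and `hq` are ordered as
`(q, x̂, x)`. -/
structure YoulaPolicy (n m nq : ℕ) where
  s : Vec n → Vec n
  K : Matrix (Fin m) (Fin n) ℝ
  fq : Vec nq × Vec n × Vec n → Vec nq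
  hq : Vec nq × Vec n × Vec n → Vec m
  contDiff_fq : ContDiff ℝ 1 fq
  contDiff_hq : ContDiff ℝ 1 hq

namespace YoulaPolicy

variable {n m nq : ℕ}

/-- The control `u = K x̂ + h_q(q, x̂, x)`, with internal state `z = (x̂, q)`. -/
noncomputable def control (Q : YoulaPolicy n m nq) (z : Vec n × Vec nq) (x : Vec n) : Vec m :=
  matVec Q.K z.1 + Q.hq (z.2, z.1, x)

/-- The policy `x̂' = f(x) - s(x - x̂) + g(x) u`, `q' = f_q(q, x̂, x)`, `u = K x̂ + h_q(q, x̂, x)`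
with internal state `(x̂, q)`. -/
noncomputable def toPolicy (Q : YoulaPolicy n m nq) (f : Vec n → Vec n)
    (g : Vec n → Matrix (Fin n) (Fin m) ℝ) : Policy n m (Vec n × Vec nq) where
  dyn z x := (f x - Q.s (x - z.1) + matVec (g x) (Q.control z x), Q.fq (z.2, z.1, x))
  out z x := Q.control z x

/-- The four conditions on an observer-plus-Youla policy for the plant `ẋ = f(x) + g(x) u`. -/
structure Admissible (Q : YoulaPolicy n m nq) (f : Vec n → Vec n)
    (g : Vec n → Matrix (Fin n) (Fin m) ℝ) : Prop where
  hurwitz : IsHurwitz (jacobianMatrix f 0 + g 0 * Q.K)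
  contDiff_s : ContDiff ℝ 1 Q.s
  stable_s : LocallyExpStable Q.s
  stable_fq : LocallyExpStable fun q => Q.fq (q, 0, 0)
  fq_diag : ∀ q y, Q.fq (q, y, y) = Q.fq (q, 0, 0)
  hq_diag : ∀ q y, Q.hq (q, y, y) = Q.hq (q, 0, 0)
  hq_zero : Q.hq (0, 0, 0) = 0

end YoulaPolicy

/-! For a `C¹` field, local exponential stability is equivalent to exponential decay of the
linearized flow (`locallyExpStable_of_expDecay`, `LocallyExpStable.expDecay`), and for matrices this
decay is the Hurwitz property (`IsHurwitz.expDecay`, `isHurwitz_of_expDecay`). One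
variation-of-constants estimate, `ExpDecayRate.norm_le_of_forcing`, drives most of these arguments.

Sufficiency: write A, B, S for f'(0), g(0), s'(0). By (iv), the derivatives of `fq` and `hq` see x
and x̂ only through e = x - x̂. In the coordinates (e, q, x) the linearized closed loop is therefore
block triangular, with diagonal blocks S, the q-linearization of `fq` and A + BK. All three decay,
and `ExpDecay.cascade` combines them.

Necessity: take K = κ'(0) and the linear map s = A + BK. Let q = (ξ, z), where ξ duplicates x̂ and z
is the state of C, and feed C the reading x - x̂ + ξ. When x = x̂, the q-dynamics are the closed
loop of C with state (ξ, z), hence stable. From ξ(0) = x̂(0), uniqueness keeps ξ = x̂, so the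
reading is x and the control is that of C. -/

open Set Filter Topology
open scoped NNReal


/-! ### Linear flows with forcing. -/

section LinearTheory

variable {E : Type*} [NormedAddCommGroup E] [NormedSpace ℝ E]

/-- The flow `exp (t L)` of a linear vector field decays exponentially, at rate at least `ρ`. -/
def ExpDecayRate (L : E →L[ℝ] E) (k ρ : ℝ) : Prop :=
  ∀ t : ℝ, 0 ≤ t → ‖NormedSpace.exp (t • L)‖ ≤ k * Real.exp (-ρ * t)

/-- The flow `exp (t L)` of a linear vector field decays exponentially. -/
def ExpDecay (L : E →L[ℝ] E) : Prop :=
  ∃ k > (0 : ℝ), ∃ ρ > (0 : ℝ), ExpDecayRate L k ρ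

theorem exp_neg_smul_mul_exp_smul [CompleteSpace E] (L : E →L[ℝ] E) (t : ℝ) :
    NormedSpace.exp (t • L) * NormedSpace.exp (-t • L) = 1 := by
  let _ : NormedAlgebra ℚ (E →L[ℝ] E) := NormedAlgebra.restrictScalars ℚ ℝ _
  rw [← NormedSpace.exp_add_of_commute]
  · rw [← add_smul]; simp
  · exact ((Commute.refl L).smul_left _).smul_right _

/-- Variation of constants, as a bound: a forced linear system with exponentially decaying flow
and exponentially decaying forcing decays. -/
theorem ExpDecayRate.norm_le_of_forcing [CompleteSpace E] {L : E →L[ℝ] E} {k ρ r C : ℝ}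
    (hk : 0 ≤ k) (hL : ExpDecayRate L k ρ) (hr : r < ρ)
    {y z : ℝ → E} (hy : ∀ t, 0 ≤ t → HasDerivWithinAt y (L (y t) + z t) (Ici 0) t)
    (hz : ∀ t, 0 ≤ t → ‖z t‖ ≤ C * Real.exp (-r * t)) (t : ℝ) (ht : 0 ≤ t) :
    ‖y t‖ ≤ k * (‖y 0‖ + C / (ρ - r)) * Real.exp (-r * t) := by
  have hC : 0 ≤ C := by
    have := (norm_nonneg _).trans (hz 0 le_rfl)
    simpa using this
  have hrρ : 0 < ρ - r := sub_pos.2 hr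
  have hE : ∀ s, HasDerivAt (fun s : ℝ => NormedSpace.exp ((t - s) • L))
      (-(NormedSpace.exp ((t - s) • L) * L)) s := fun s => by
    have := (hasDerivAt_exp_smul_const (𝕂 := ℝ) L (t - s)).scomp s
      ((hasDerivAt_id s).const_sub t)
    simpa [Function.comp_def] using this
  -- Transporting y(s) to time t by the flow cancels the `L` term and leaves only the forcing.
  have hw : ∀ s, 0 ≤ s → HasDerivWithinAt (fun s => NormedSpace.exp ((t - s) • L) (y s))
      (NormedSpace.exp ((t - s) • L) (z s)) (Ici 0) s := fun s hs => by
    convert (hE s).hasDerivWithinAt.clm_apply (hy s hs) using 1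
    simp
  -- An antiderivative of the bound on the derivative; it is not normalized to vanish at 0, which
  -- only adds a nonnegative constant.
  have hB : ∀ s, HasDerivAt (fun s => k * Real.exp (-ρ * t) * ‖y 0‖
        + k * C * Real.exp (-ρ * t) / (ρ - r) * Real.exp ((ρ - r) * s))
      (k * C * Real.exp (-ρ * t) * Real.exp ((ρ - r) * s)) s := fun s => by
    have := (((hasDerivAt_id s).const_mul (ρ - r)).exp.const_mul
      (k * C * Real.exp (-ρ * t) / (ρ - r))).const_add (k * Real.exp (-ρ * t) * ‖y 0‖)
    refine this.congr_deriv ?_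
    field_simp
    simp
  have key := image_norm_le_of_norm_deriv_right_le_deriv_boundary
    (f := fun s => NormedSpace.exp ((t - s) • L) (y s)) (a := 0) (b := t)
    (fun s hs => ((hw s hs.1).continuousWithinAt).mono fun _ h => h.1)
    (fun s hs => (hw s hs.1).mono (Ici_subset_Ici.2 hs.1)) ?_ hB ?_
    (right_mem_Icc.2 ht)
  · simp only [sub_self, zero_smul, NormedSpace.exp_zero, one_apply_eq_self] at key
    refine key.trans ?_
    have h1 : Real.exp (-ρ * t) * Real.exp ((ρ - r) * t) = Real.exp (-r * t) := by
      rw [← Real.exp_add]; ring_nf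
    have h2 : Real.exp (-ρ * t) ≤ Real.exp (-r * t) :=
      Real.exp_le_exp.2 (by nlinarith)
    calc _ = k * ‖y 0‖ * Real.exp (-ρ * t)
          + k * C / (ρ - r) * (Real.exp (-ρ * t) * Real.exp ((ρ - r) * t)) := by ring
      _ ≤ k * ‖y 0‖ * Real.exp (-r * t) + k * C / (ρ - r) * Real.exp (-r * t) := by
          rw [h1]; gcongr
      _ = _ := by ring
  · simp only [sub_zero, mul_zero, Real.exp_zero, mul_one]
    refine (ContinuousLinearMap.le_opNorm _ _).trans ?_
    have : 0 ≤ k * C * Real.exp (-ρ * t) / (ρ - r) := by positivity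
    have := mul_le_mul_of_nonneg_right (hL t ht) (norm_nonneg (y 0))
    linarith
  · intro s hs
    refine (ContinuousLinearMap.le_opNorm _ _).trans ?_
    calc _ ≤ (k * Real.exp (-ρ * (t - s))) * (C * Real.exp (-r * s)) :=
          mul_le_mul (hL _ (by linarith [hs.2])) (hz s hs.1) (norm_nonneg _) (by positivity)
      _ = k * C * (Real.exp (-ρ * (t - s)) * Real.exp (-r * s)) := by ring
      _ = k * C * (Real.exp (-ρ * t) * Real.exp ((ρ - r) * s)) := by
          rw [← Real.exp_add, ← Real.exp_add]; ring_nf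
      _ = _ := by ring

theorem hasDerivAt_exp_smul_apply [CompleteSpace E] (L : E →L[ℝ] E) (v : E) (t : ℝ) :
    HasDerivAt (fun s : ℝ => NormedSpace.exp (s • L) v) (L (NormedSpace.exp (t • L) v)) t := by
  have := (hasDerivAt_exp_smul_const' (𝕂 := ℝ) L t).clm_apply (hasDerivAt_const t v)
  simpa using this

theorem isForwardSolution_exp [CompleteSpace E] (L : E →L[ℝ] E) (v : E) :
    IsForwardSolution L fun t : ℝ => NormedSpace.exp (t • L) v :=
  fun t _ => (hasDerivAt_exp_smul_apply L v t).hasDerivWithinAt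

/-- A decay estimate along all solutions bounds the exponential. -/
theorem expDecayRate_of_solutions [CompleteSpace E] {L : E →L[ℝ] E} {k ρ : ℝ} (hk : 0 ≤ k)
    (h : ∀ x, IsForwardSolution L x → ∀ t, 0 ≤ t → ‖x t‖ ≤ k * ‖x 0‖ * Real.exp (-ρ * t)) :
    ExpDecayRate L k ρ := fun t ht => by
  refine ContinuousLinearMap.opNorm_le_bound _ (by positivity) fun v => ?_
  have := h _ (isForwardSolution_exp L v) t ht
  simp only [zero_smul, NormedSpace.exp_zero, one_apply_eq_self] at this
  linarith

/-- A continuous forcing on an interval has an indefinite integral there. -/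
theorem exists_primitive_within [CompleteSpace E] {J : Set ℝ} (hJ : J.OrdConnected)
    (h0 : (0 : ℝ) ∈ J) (hJ0 : J ⊆ Ici 0) {φ : ℝ → E} (hφ : ContinuousOn φ J) :
    ∃ y : ℝ → E, y 0 = 0 ∧ ∀ t ∈ J, HasDerivWithinAt y (φ t) J t := by
  refine ⟨fun t => ∫ s in (0 : ℝ)..t, φ s, by simp, fun t ht => ?_⟩
  -- Either `J` continues beyond `t`, or `t` is its maximum and `b = t`. Extending `φ` constantly
  -- outside `[0, b]` then allows the two-sided fundamental theorem.
  obtain ⟨b, hb, htb, hn⟩ : ∃ b ∈ J, t ≤ b ∧ Icc 0 b ∈ 𝓝[J] t := by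
    by_cases h : ∃ b ∈ J, t < b
    · obtain ⟨b, hb, htb⟩ := h
      refine ⟨b, hb, htb.le, ?_⟩
      filter_upwards [self_mem_nhdsWithin, nhdsWithin_le_nhds (Iio_mem_nhds htb)] with s hs hs'
      exact ⟨hJ0 hs, le_of_lt hs'⟩
    · push Not at h
      refine ⟨t, ht, le_rfl, ?_⟩
      filter_upwards [self_mem_nhdsWithin] with s hs
      exact ⟨hJ0 hs, h s hs⟩
  have hb0 : (0 : ℝ) ≤ b := hJ0 hb
  have hsub : Icc 0 b ⊆ J := hJ.out h0 hb
  have ht' : t ∈ Icc 0 b := ⟨hJ0 ht, htb⟩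
  set ψ : ℝ → E := IccExtend hb0 ((Icc 0 b).domRestrict φ) with hψ
  have hψc : Continuous ψ := (hφ.mono hsub).domRestrict.Icc_extend'
  have hψe : ∀ s ∈ Icc 0 b, ψ s = φ s := fun s hs => by
    rw [hψ, IccExtend_of_mem hb0 _ hs]; rfl
  have hd : HasDerivWithinAt (fun t => ∫ s in (0 : ℝ)..t, ψ s) (ψ t) J t :=
    (intervalIntegral.integral_hasDerivAt_right (hψc.intervalIntegrable _ _)
      hψc.stronglyMeasurable.stronglyMeasurableAtFilter hψc.continuousAt).hasDerivWithinAt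
  have heq : ∀ u ∈ Icc 0 b, (∫ s in (0 : ℝ)..u, φ s) = ∫ s in (0 : ℝ)..u, ψ s := fun u hu => by
    refine intervalIntegral.integral_congr fun s hs => ?_
    rw [uIcc_of_le hu.1] at hs
    exact (hψe s ⟨hs.1, hs.2.trans hu.2⟩).symm
  rw [hψe t ht'] at hd
  exact hd.congr_of_eventuallyEq (by filter_upwards [hn] with u hu using heq u hu) (heq t ht')

/-- Solutions of forced linear systems exist. -/
theorem exists_forced_linear_solution [CompleteSpace E] (L : E →L[ℝ] E) {J : Set ℝ}
    (hJ : J.OrdConnected) (h0 : (0 : ℝ) ∈ J) (hJ0 : J ⊆ Ici 0) {φ : ℝ → E}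
    (hφ : ContinuousOn φ J) (y₀ : E) :
    ∃ y : ℝ → E, y 0 = y₀ ∧ ∀ t ∈ J, HasDerivWithinAt y (L (y t) + φ t) J t := by
  have hc : Continuous fun s : ℝ => NormedSpace.exp (-s • L) := by
    let _ : NormedAlgebra ℚ (E →L[ℝ] E) := NormedAlgebra.restrictScalars ℚ ℝ _
    exact NormedSpace.exp_continuous.comp (by fun_prop)
  obtain ⟨w, hw0, hw⟩ := exists_primitive_within hJ h0 hJ0
    (φ := fun s => NormedSpace.exp (-s • L) (φ s)) (hc.continuousOn.clm_apply hφ)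
  refine ⟨fun t => NormedSpace.exp (t • L) (y₀ + w t), by simp [hw0], fun t ht => ?_⟩
  have := (hasDerivAt_exp_smul_const' (𝕂 := ℝ) L t).hasDerivWithinAt.clm_apply
    ((hw t ht).const_add y₀)
  convert this using 1
  have h1 := congrArg (fun A : E →L[ℝ] E => A (φ t)) (exp_neg_smul_mul_exp_smul L t)
  simp only [mul_apply_eq_comp, one_apply_eq_self] at h1
  rw [h1]; simp

end LinearTheory

/-! ### Local exponential stability versus decay of the linearization. -/

section NonlinearTheory

variable {E : Type*} [NormedAddCommGroup E] [NormedSpace ℝ E]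

/-- Lyapunov–Perron: a small Lipschitz perturbation of an exponentially decaying linear system has
exponentially decaying solutions. -/
theorem exists_decaying_solution_of_lipschitz [CompleteSpace E] {L : E →L[ℝ] E} {k ρ r : ℝ}
    (hk : 0 ≤ k) (hL : ExpDecayRate L k ρ) (hr : r < ρ) {R : E → E} {K : ℝ≥0}
    (hR : LipschitzWith K R) (hR0 : R 0 = 0) (hK : k * (K / (ρ - r)) ≤ 1 / 2) (x₀ : E) :
    ∃ y : ℝ → E, y 0 = x₀ ∧
      (∀ t, 0 ≤ t → HasDerivWithinAt y (L (y t) + R (y t)) (Ici 0) t) ∧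
      ∀ t, 0 ≤ t → ‖y t‖ ≤ 2 * k * ‖x₀‖ * Real.exp (-r * t) := by
  have hrρ : 0 < ρ - r := sub_pos.2 hr
  -- The unknown is the weighted curve Y(t) = exp(rt) y(t), so that boundedness of Y encodes the
  -- decay; a fixed point of Y ↦ exp(rt) `sol Y` solves the equation.
  have hex : ∀ Y : BoundedContinuousFunction ℝ E, ∃ y : ℝ → E, y 0 = x₀ ∧
      ∀ t ∈ Ici (0 : ℝ), HasDerivWithinAt y (L (y t) + R (Real.exp (-r * t) • Y t)) (Ici 0) t :=
    fun Y => exists_forced_linear_solution L ordConnected_Ici self_mem_Ici subset_rfl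
      (φ := fun t => R (Real.exp (-r * t) • Y t))
      (hR.continuous.comp (by fun_prop)).continuousOn x₀
  choose sol hs0 hs using hex
  have hbound : ∀ Y t, 0 ≤ t →
      ‖sol Y t‖ ≤ k * (‖x₀‖ + K * ‖Y‖ / (ρ - r)) * Real.exp (-r * t) := fun Y t ht => by
    have := hL.norm_le_of_forcing hk hr (hs Y) (C := K * ‖Y‖) (fun s hs => by
      have h1 := hR.norm_sub_le (Real.exp (-r * s) • Y s) 0
      rw [hR0, sub_zero, sub_zero, norm_smul, Real.norm_of_nonneg (Real.exp_pos _).le] at h1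
      refine h1.trans ?_
      calc _ ≤ (K : ℝ) * (Real.exp (-r * s) * ‖Y‖) := by gcongr; exact Y.norm_coe_le_norm s
        _ = _ := by ring) t ht
    rwa [hs0] at this
  have hdiff : ∀ Y Y' t, 0 ≤ t →
      ‖sol Y t - sol Y' t‖ ≤ 1 / 2 * dist Y Y' * Real.exp (-r * t) := fun Y Y' t ht => by
    have := hL.norm_le_of_forcing hk hr (y := fun t => sol Y t - sol Y' t)
      (z := fun t => R (Real.exp (-r * t) • Y t) - R (Real.exp (-r * t) • Y' t))
      (C := K * dist Y Y') (fun s hs' => by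
        refine ((hs Y s hs').sub (hs Y' s hs')).congr_deriv ?_
        rw [map_sub]; abel) (fun s hs' => by
        have h1 := hR.norm_sub_le (Real.exp (-r * s) • Y s) (Real.exp (-r * s) • Y' s)
        rw [← smul_sub, norm_smul, Real.norm_of_nonneg (Real.exp_pos _).le, ← dist_eq_norm (Y s)]
          at h1
        refine h1.trans ?_
        calc _ ≤ (K : ℝ) * (Real.exp (-r * s) * dist Y Y') := by
              gcongr; exact BoundedContinuousFunction.dist_coe_le_dist s
          _ = _ := by ring) t ht
    refine this.trans ?_
    rw [hs0, hs0, sub_self, norm_zero, zero_add]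
    have h2 := mul_le_mul_of_nonneg_right hK (dist_nonneg (x := Y) (y := Y'))
    refine mul_le_mul_of_nonneg_right (le_trans (le_of_eq ?_) h2) (Real.exp_pos _).le
    ring
  have hcont : ∀ Y, Continuous fun t : ℝ => Real.exp (r * max t 0) • sol Y (max t 0) := fun Y => by
    refine Continuous.smul (by fun_prop) ?_
    have : ContinuousOn (sol Y) (Ici 0) := fun t ht => (hs Y t ht).continuousWithinAt
    exact this.comp_continuous (by fun_prop) fun t => mem_Ici.2 (le_max_right _ _)
  have hexp : ∀ (C t : ℝ) (v : E), ‖v‖ ≤ C * Real.exp (-r * t) → ‖Real.exp (r * t) • v‖ ≤ C :=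
    fun C t v h => by
      rw [norm_smul, Real.norm_of_nonneg (Real.exp_pos _).le]
      calc _ ≤ Real.exp (r * t) * (C * Real.exp (-r * t)) := by gcongr
        _ = C * (Real.exp (r * t) * Real.exp (-r * t)) := by ring
        _ = C := by rw [← Real.exp_add]; simp
  let Φ : BoundedContinuousFunction ℝ E → BoundedContinuousFunction ℝ E := fun Y =>
    BoundedContinuousFunction.ofNormedAddCommGroup
      (fun t => Real.exp (r * max t 0) • sol Y (max t 0)) (hcont Y)
      (k * (‖x₀‖ + K * ‖Y‖ / (ρ - r))) fun t => hexp _ _ _ (hbound Y _ (le_max_right _ _))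
  have hΦ : ContractingWith (1 / 2) Φ := by
    refine ⟨by norm_num, LipschitzWith.of_dist_le_mul fun Y Y' => ?_⟩
    refine (BoundedContinuousFunction.dist_le (by positivity)).2 fun t => ?_
    simp only [Φ, BoundedContinuousFunction.coe_ofNormedAddCommGroup, dist_eq_norm (Real.exp _ • _),
      ← smul_sub]
    exact hexp _ _ _ (by simpa using hdiff Y Y' _ (le_max_right t 0))
  have : Nonempty (BoundedContinuousFunction ℝ E) := ⟨0⟩
  set Y := hΦ.fixedPoint Φ with hY
  have hfix : Φ Y = Y := hΦ.fixedPoint_isFixedPt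
  have hYt : ∀ t, 0 ≤ t → Real.exp (-r * t) • Y t = sol Y t := fun t ht => by
    have h1 : Y t = Real.exp (r * max t 0) • sol Y (max t 0) := (DFunLike.congr_fun hfix t).symm
    rw [h1, max_eq_left ht, smul_smul, ← Real.exp_add]
    simp
  -- The fixed-point bound reads ‖Y‖ ≤ k‖x₀‖ + ‖Y‖/2, and the last term is absorbed.
  have hYn : ‖Y‖ ≤ 2 * k * ‖x₀‖ := by
    have h1 : ‖Y‖ ≤ k * (‖x₀‖ + K * ‖Y‖ / (ρ - r)) := by
      conv_lhs => rw [← hfix]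
      exact BoundedContinuousFunction.norm_ofNormedAddCommGroup_le (hcont Y) (by positivity)
        (fun t => hexp _ _ _ (hbound Y _ (le_max_right _ _)))
    have h2 := mul_le_mul_of_nonneg_right hK (norm_nonneg Y)
    have h3 : k * (‖x₀‖ + K * ‖Y‖ / (ρ - r)) = k * ‖x₀‖ + k * (K / (ρ - r)) * ‖Y‖ := by ring
    linarith
  refine ⟨sol Y, hs0 Y, fun t ht => ?_, fun t ht => ?_⟩
  · have := hs Y t ht
    rwa [hYt t ht] at this
  · rw [← hYt t ht, norm_smul, Real.norm_of_nonneg (Real.exp_pos _).le, mul_comm]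
    gcongr
    exact (Y.norm_coe_le_norm t).trans hYn

theorem IsForwardSolution.continuousOn {F : E → E} {x : ℝ → E} (hx : IsForwardSolution F x) :
    ContinuousOn x (Ici 0) := fun t ht => (hx t ht).continuousWithinAt

/-- A `C¹` map is Lipschitz on closed balls of a finite-dimensional space. -/
theorem ContDiff.exists_lipschitzOnWith_closedBall [FiniteDimensional ℝ E] {F' : Type*}
    [NormedAddCommGroup F'] [NormedSpace ℝ F'] {F : E → F'} (hF : ContDiff ℝ 1 F) (M : ℝ) :
    ∃ K, LipschitzOnWith K F (Metric.closedBall 0 M) :=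
  hF.contDiffOn.exists_lipschitzOnWith one_ne_zero (convex_closedBall _ _)
    (isCompact_closedBall _ _)

/-- Forward solutions of a `C¹` vector field are unique. -/
theorem IsForwardSolution.unique [FiniteDimensional ℝ E] {F : E → E} (hF : ContDiff ℝ 1 F)
    {x y : ℝ → E} (hx : IsForwardSolution F x) (hy : IsForwardSolution F y) (h0 : x 0 = y 0)
    (T : ℝ) (hT : 0 ≤ T) : x T = y T := by
  have hxc : ContinuousOn x (Icc 0 T) := hx.continuousOn.mono fun _ h => h.1
  have hyc : ContinuousOn y (Icc 0 T) := hy.continuousOn.mono fun _ h => h.1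
  obtain ⟨M, hM⟩ := isCompact_Icc.exists_bound_of_continuousOn hxc
  obtain ⟨N, hN⟩ := isCompact_Icc.exists_bound_of_continuousOn hyc
  obtain ⟨K, hK⟩ := hF.exists_lipschitzOnWith_closedBall (max M N)
  exact ODE_solution_unique_of_mem_Icc_right (v := fun _ => F)
    (s := fun _ => Metric.closedBall 0 (max M N)) (fun _ _ => hK) hxc
    (fun t ht => (hx t ht.1).mono (Ici_subset_Ici.2 ht.1))
    (fun t ht => by
      simpa using Or.inl (hM t ⟨ht.1, ht.2.le⟩)) hyc
    (fun t ht => (hy t ht.1).mono (Ici_subset_Ici.2 ht.1))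
    (fun t ht => by
      simpa using Or.inr (hN t ⟨ht.1, ht.2.le⟩)) h0 (right_mem_Icc.2 hT)

/-- Lyapunov's indirect method: an exponentially decaying linearization makes the origin of a `C¹`
vector field locally exponentially stable. -/
theorem locallyExpStable_of_expDecay [FiniteDimensional ℝ E] {F : E → E} (hF : ContDiff ℝ 1 F)
    (hF0 : F 0 = 0) {L : E →L[ℝ] E} (hFL : HasFDerivAt F L 0) (hL : ExpDecay L) :
    LocallyExpStable F := by
  obtain ⟨k, hk, ρ, hρ, hL⟩ := hL
  have hstrict : HasStrictFDerivAt F L 0 :=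
    hF.contDiffAt.hasStrictFDerivAt' hFL one_ne_zero
  set c₀ := lipschitzExtensionConstant E
  have hc₀ : 0 < c₀ := lipschitzExtensionConstant_pos E
  -- Extending the remainder F - L from a ball to all of E multiplies its Lipschitz constant by
  -- `c₀`; the chosen `ε` gives exactly 1/2.
  obtain ⟨ε, hε⟩ : ∃ ε : ℝ≥0, 0 < ε ∧ k * ((c₀ * ε : ℝ≥0) / (ρ - ρ / 2)) ≤ 1 / 2 := by
    lift k to ℝ≥0 using hk.le
    lift ρ to ℝ≥0 using hρ.le
    refine ⟨ρ / (4 * k * c₀), div_pos (by exact_mod_cast hρ)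
      (mul_pos (mul_pos (by norm_num) (by exact_mod_cast hk)) hc₀), ?_⟩
    push_cast
    have : (0 : ℝ) < c₀ := hc₀
    apply le_of_eq
    field_simp
    norm_num
  obtain ⟨s, hs, hsε⟩ := hstrict.approximates_deriv_on_nhds (Or.inr hε.1)
  obtain ⟨δ, hδ, hδs⟩ := Metric.mem_nhds_iff.1 hs
  obtain ⟨R, hRlip, hReq⟩ := (hsε.lipschitzOnWith.mono hδs).extend_finite_dimension
  have hR0 : R 0 = 0 := by
    rw [← hReq (Metric.mem_ball_self hδ)]
    simp [hF0]
  -- The radius keeps 2k‖x₀‖ below `δ`, so the solution never leaves the ball where the extension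
  -- agrees with F - L.
  refine ⟨δ / (2 * k), by positivity, 2 * k, by positivity, ρ / 2, by positivity, fun x₀ hx₀ => ?_⟩
  obtain ⟨y, hy0, hyd, hyb⟩ := exists_decaying_solution_of_lipschitz hk.le hL (half_lt_self hρ)
    hRlip hR0 hε.2 x₀
  have hball : ∀ t, 0 ≤ t → y t ∈ Metric.ball (0 : E) δ := fun t ht => by
    rw [mem_ball_zero_iff]
    refine (hyb t ht).trans_lt ?_
    rw [lt_div_iff₀ (by positivity)] at hx₀
    have : Real.exp (-(ρ / 2) * t) ≤ 1 := Real.exp_le_one_iff.2 (by nlinarith)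
    calc _ ≤ 2 * k * ‖x₀‖ * 1 := by gcongr
      _ < δ := by linarith
  have hyF : IsForwardSolution F y := fun t ht => by
    refine (hyd t ht).congr_deriv ?_
    rw [← hReq (hball t ht)]
    simp
  refine ⟨⟨y, hy0, hyF⟩, fun x hx0 hx t ht => ?_⟩
  rw [hx.unique hF hyF (hx0.trans hy0.symm) t ht]
  exact hyb t ht

/-- The estimate with x₀ = 0 forces the solution to vanish identically, so its derivative at 0 is
both `F 0` and 0. -/
theorem LocallyExpStable.map_zero {F : E → E} (h : LocallyExpStable F) : F 0 = 0 := by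
  obtain ⟨c, hc, k, _, r, _, h⟩ := h
  obtain ⟨⟨x, hx0, hx⟩, hb⟩ := h 0 (by simpa using hc)
  have h0 : ∀ t ∈ Ici (0 : ℝ), x t = 0 := fun t ht => by
    simpa using hb x hx0 hx t ht
  have h1 := hx 0 le_rfl
  rw [hx0] at h1
  exact (uniqueDiffOn_Ici (0 : ℝ) 0 self_mem_Ici).eq_deriv _ h1
    ((hasDerivWithinAt_const 0 _ (0 : E)).congr h0 hx0)

/-- The converse of Lyapunov's indirect method: the linearization of a vector field with a locally
exponentially stable origin decays exponentially. -/
theorem LocallyExpStable.expDecay [CompleteSpace E] {F : E → E} {L : E →L[ℝ] E}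
    (h : LocallyExpStable F) (hFL : HasFDerivAt F L 0) : ExpDecay L := by
  have hF0 := h.map_zero
  obtain ⟨c, hc, k, hk, r, hr, h⟩ := h
  refine ⟨k, hk, r, hr, fun t ht => ContinuousLinearMap.opNorm_le_bound _ (by positivity)
    fun v => ?_⟩
  set B := k * ‖v‖ with hB
  have hB0 : 0 ≤ B := by positivity
  -- For small η, the rescaled solution η⁻¹x from ηv solves the linear equation up to an error εB.
  -- Grönwall compares it with exp(tL)v, and ε → 0 removes the error.
  have key : ∀ ε > 0, ‖NormedSpace.exp (t • L) v‖ ≤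
      k * ‖v‖ * Real.exp (-r * t) + gronwallBound 0 ‖L‖ (ε * B) t := fun ε hε => by
    have hsmall := (hasFDerivAt_iff_isLittleO_nhds_zero.1 hFL).def hε
    obtain ⟨δ, hδ, hδs⟩ := Metric.eventually_nhds_iff.1 hsmall
    obtain ⟨η, hη, hηc, hηδ⟩ : ∃ η : ℝ, 0 < η ∧ η * ‖v‖ < c ∧ η * B < δ := by
      have hlim : ∀ b : ℝ, Tendsto (fun η : ℝ => η * b) (𝓝[>] 0) (𝓝 0) := fun b =>
        tendsto_nhdsWithin_of_tendsto_nhds <| by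
          simpa using (continuous_mul_const b).tendsto 0
      obtain ⟨η, h1, h2, h3⟩ := (eventually_mem_nhdsWithin.and
        (((hlim ‖v‖).eventually (gt_mem_nhds hc)).and
          ((hlim B).eventually (gt_mem_nhds hδ)))).exists
      exact ⟨η, h1, h2, h3⟩
    obtain ⟨⟨x, hx0, hx⟩, hb⟩ := h (η • v) (by rwa [norm_smul, Real.norm_of_nonneg hη.le])
    have hxb : ∀ s, 0 ≤ s → ‖x s‖ ≤ η * (k * ‖v‖ * Real.exp (-r * s)) := fun s hs => by
      have := hb x hx0 hx s hs
      rw [norm_smul, Real.norm_of_nonneg hη.le] at this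
      linarith
    have hxB : ∀ s, 0 ≤ s → ‖x s‖ ≤ η * B := fun s hs => (hxb s hs).trans <| by
      have : Real.exp (-r * s) ≤ 1 := Real.exp_le_one_iff.2 (by nlinarith)
      gcongr
      exact mul_le_of_le_one_right hB0 this
    have hlip : ∀ _ : ℝ, LipschitzWith ‖L‖₊ L := fun _ => L.lipschitz
    have hyd : ∀ s, 0 ≤ s →
        HasDerivWithinAt (fun s => η⁻¹ • x s) (η⁻¹ • F (x s)) (Ici 0) s :=
      fun s hs => (hx s hs).const_smul η⁻¹
    have := dist_le_of_approx_trajectories_ODE (v := fun _ => L) (a := 0) (b := t) (εf := 0)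
      (εg := ε * B) (δ := 0) (K := ‖L‖₊) (f := fun s : ℝ => NormedSpace.exp (s • L) v)
      (g := fun s => η⁻¹ • x s) hlip
      (fun s _ => (hasDerivAt_exp_smul_apply L v s).continuousAt.continuousWithinAt)
      (fun s _ => (hasDerivAt_exp_smul_apply L v s).hasDerivWithinAt) (fun s _ => by simp)
      (fun s hs => (hyd s hs.1).continuousWithinAt.mono fun _ h => h.1)
      (fun s hs => (hyd s hs.1).mono (Ici_subset_Ici.2 hs.1))
      (fun s hs => by
        have h1 : ‖F (x s) - L (x s)‖ ≤ ε * ‖x s‖ := by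
          have := hδs (y := x s) (by
            rw [dist_zero_right]; exact (hxB s hs.1).trans_lt hηδ)
          simpa [hF0] using this
        rw [dist_eq_norm, map_smul, ← smul_sub, norm_smul, norm_inv, Real.norm_of_nonneg hη.le,
          inv_mul_le_iff₀ hη]
        calc _ ≤ ε * (η * B) := h1.trans (by gcongr; exact hxB s hs.1)
          _ = _ := by ring)
      (by simp [hx0, smul_smul, hη.ne']) t ⟨ht, le_rfl⟩
    simp only [zero_add, sub_zero, coe_nnnorm] at this
    have h2 : ‖η⁻¹ • x t‖ ≤ k * ‖v‖ * Real.exp (-r * t) := by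
      rw [norm_smul, norm_inv, Real.norm_of_nonneg hη.le, inv_mul_le_iff₀ hη]
      exact hxb t ht
    rw [dist_eq_norm] at this
    have h3 := norm_le_norm_add_norm_sub' (NormedSpace.exp (t • L) v) (η⁻¹ • x t)
    linarith
  have hlim : Tendsto (fun ε : ℝ => k * ‖v‖ * Real.exp (-r * t) + gronwallBound 0 ‖L‖ (ε * B) t)
      (𝓝[>] 0) (𝓝 (k * ‖v‖ * Real.exp (-r * t) + gronwallBound 0 ‖L‖ (0 * B) t)) :=
    tendsto_nhdsWithin_of_tendsto_nhds ((continuous_const.add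
      ((gronwallBound_continuous_ε 0 ‖L‖ t).comp (continuous_id.mul continuous_const))).tendsto 0)
  have := ge_of_tendsto hlim (by filter_upwards [self_mem_nhdsWithin] with ε hε using key ε hε)
  rw [zero_mul, gronwallBound_ε0_δ0, add_zero] at this
  linarith

end NonlinearTheory

/-! ### Hurwitz matrices and exponential decay. -/

section Hurwitz

open Polynomial

theorem HasDerivWithinAt.map_clm {E F : Type*} [NormedAddCommGroup E] [NormedSpace ℝ E]
    [NormedAddCommGroup F] [NormedSpace ℝ F] (A : E →L[ℝ] F) {x : ℝ → E} {x' : E} {s : Set ℝ}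
    {t : ℝ} (h : HasDerivWithinAt x x' s t) : HasDerivWithinAt (fun t => A (x t)) (A x') s t :=
  A.hasFDerivAt.comp_hasDerivWithinAt t h

/-- Along a solution, exp(-μs) x(s) is constant. This is the scalar system to which each factor X -
μ of the characteristic polynomial reduces. -/
theorem expDecayRate_smul_one {W : Type*} [NormedAddCommGroup W] [NormedSpace ℂ W]
    [CompleteSpace W] (μ : ℂ) : ExpDecayRate (μ • (1 : W →L[ℝ] W)) 1 (-μ.re) := by
  refine expDecayRate_of_solutions zero_le_one fun x hx t ht => ?_
  have hd : ∀ s, 0 ≤ s →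
      HasDerivWithinAt (fun s : ℝ => Complex.exp (-(μ * s)) • x s) 0 (Ici 0) s := fun s hs => by
    have h1 : HasDerivAt (fun s : ℝ => Complex.exp (-(μ * s)))
        (Complex.exp (-(μ * s)) * -(μ * 1)) s :=
      (((hasDerivAt_id (s : ℂ)).comp_ofReal.const_mul μ).neg).cexp
    refine (h1.hasDerivWithinAt.smul (hx s hs)).congr_deriv ?_
    simp [smul_smul, mul_comm]
  have h := constant_of_has_deriv_right_zero (a := 0) (b := t)
    (fun s hs => (hd s hs.1).continuousWithinAt.mono fun _ h => h.1)
    (fun s hs => (hd s hs.1).mono (Ici_subset_Ici.2 hs.1)) t ⟨ht, le_rfl⟩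
  have h2 : x t = Complex.exp (μ * t) • x 0 := by
    simp only [Complex.ofReal_zero, mul_zero, neg_zero, Complex.exp_zero, one_smul] at h
    rw [← h, smul_smul, ← Complex.exp_add]
    simp
  rw [h2, norm_smul, Complex.norm_exp]
  simp [mul_comm]

/-- Solutions of `ẋ = T x` annihilated by `∏ (T - μ)` decay when every `Re μ < -r`. -/
theorem exists_decay_of_aeval_prod_eq_zero {W : Type*} [NormedAddCommGroup W] [NormedSpace ℂ W]
    [CompleteSpace W] (T : W →L[ℂ] W) (r : ℝ) (l : Multiset ℂ) (hl : ∀ μ ∈ l, μ.re < -r) :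
    ∃ k : ℝ, 0 ≤ k ∧ ∀ x : ℝ → W, (∀ t, 0 ≤ t → HasDerivWithinAt x (T (x t)) (Ici 0) t) →
      (∀ t, 0 ≤ t → aeval (T : W →ₗ[ℂ] W) (l.map fun μ => X - C μ).prod (x t) = 0) →
      ∀ t, 0 ≤ t → ‖x t‖ ≤ k * ‖x 0‖ * Real.exp (-r * t) := by
  induction l using Multiset.induction_on with
  | empty =>
    refine ⟨0, le_rfl, fun x _ h t ht => ?_⟩
    have := h t ht
    simp at this
    simp [this]
  | cons μ l ih =>
    obtain ⟨k, hk, h⟩ := ih fun ν hν => hl ν (Multiset.mem_cons_of_mem hν)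
    have hμ : r < -μ.re := by linarith [hl μ (Multiset.mem_cons_self μ l)]
    have hμ' : 0 < -μ.re - r := sub_pos.2 hμ
    -- D x solves the same equation and is annihilated by the remaining factors, so it decays by
    -- induction. Then x' = μx + Dx is a scalar system with decaying forcing; the strict gap Re μ <
    -- -r absorbs polynomial factors from repeated roots.
    set D : W →L[ℂ] W := T - μ • 1 with hD
    refine ⟨1 + k * ‖D‖ / (-μ.re - r), by positivity, fun x hx hann t ht => ?_⟩
    have hy := h (fun t => D (x t)) (fun t ht => by
      refine ((hx t ht).map_clm (D.restrictScalars ℝ)).congr_deriv ?_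
      simp [hD]) (fun t ht => by
      have := hann t ht
      rw [Multiset.map_cons, Multiset.prod_cons, mul_comm, map_mul, Module.End.mul_apply] at this
      convert this using 2
      simp [hD, Module.algebraMap_end_apply])
    have hy' : ∀ s, 0 ≤ s → ‖D (x s)‖ ≤ k * ‖D‖ * ‖x 0‖ * Real.exp (-r * s) := fun s hs => by
      refine (hy s hs).trans ?_
      rw [mul_assoc k ‖D‖]
      gcongr
      exact D.le_opNorm _
    have := (expDecayRate_smul_one (W := W) μ).norm_le_of_forcing zero_le_one hμ (y := x)
      (z := fun t => D (x t)) (fun s hs => by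
        refine (hx s hs).congr_deriv ?_
        simp [hD]) hy' t ht
    refine this.trans (le_of_eq ?_)
    ring

variable {n : ℕ}

/-- A matrix as a continuous linear map of Euclidean spaces. -/
noncomputable def matCLM {k l : ℕ} (A : Matrix (Fin k) (Fin l) ℝ) : Vec l →L[ℝ] Vec k :=
  LinearMap.toContinuousLinearMap (Matrix.toEuclideanLin A)

theorem matCLM_apply {k l : ℕ} (A : Matrix (Fin k) (Fin l) ℝ) (v : Vec l) :
    matCLM A v = matVec A v := rfl

theorem matVec_apply {k l : ℕ} (A : Matrix (Fin k) (Fin l) ℝ) (v : Vec l) (i : Fin k) :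
    matVec A v i = ∑ j, A i j * v j := by
  simp [matVec, Matrix.toLpLin_apply, Matrix.mulVec, dotProduct]

/-- The embedding of real vectors into complex vectors. -/
noncomputable def complexify : Vec n →L[ℝ] (Fin n → ℂ) :=
  LinearMap.toContinuousLinearMap
    { toFun := fun v i => (v i : ℂ)
      map_add' := fun v w => by ext; simp
      map_smul' := fun c v => by ext; simp }

/-- The real part of a complex vector. -/
noncomputable def reVec : (Fin n → ℂ) →L[ℝ] Vec n :=
  LinearMap.toContinuousLinearMap
    { toFun := fun w => WithLp.toLp 2 fun i => (w i).re
      map_add' := fun v w => by ext; simp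
      map_smul' := fun c v => by ext; simp }

theorem complexify_apply (v : Vec n) (i : Fin n) : complexify v i = (v i : ℂ) := rfl

theorem reVec_apply (w : Fin n → ℂ) (i : Fin n) : reVec w i = (w i).re := rfl

theorem reVec_complexify (v : Vec n) : reVec (complexify v) = v := by
  ext i; rw [reVec_apply, complexify_apply, Complex.ofReal_re]

theorem complexify_matCLM (M : Matrix (Fin n) (Fin n) ℝ) (v : Vec n) :
    complexify (matCLM M v) = (M.map (algebraMap ℝ ℂ)).mulVec (complexify v) := by
  ext i
  simp [complexify_apply, matCLM_apply, matVec_apply, Matrix.mulVec, dotProduct]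

theorem reVec_mulVec (M : Matrix (Fin n) (Fin n) ℝ) (w : Fin n → ℂ) :
    reVec ((M.map (algebraMap ℝ ℂ)).mulVec w) = matCLM M (reVec w) := by
  ext i
  simp [reVec_apply, matCLM_apply, matVec_apply, Matrix.mulVec, dotProduct]

/-- Over ℂ the characteristic polynomial splits, and by Cayley–Hamilton it annihilates every
trajectory, so factors can be peeled off one by one without a Jordan form. -/
theorem IsHurwitz.expDecay {M : Matrix (Fin n) (Fin n) ℝ} (hM : IsHurwitz M) :
    ExpDecay (matCLM M) := by
  set Mc := M.map (algebraMap ℝ ℂ) with hMc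
  have hroots : ∀ μ ∈ Mc.charpoly.roots, μ.re < 0 := fun μ hμ => by
    refine hM μ ?_
    refine Matrix.mem_spectrum_of_isRoot_charpoly ?_
    exact isRoot_of_mem_roots hμ
  obtain ⟨r, hr, hr'⟩ : ∃ r > 0, ∀ μ ∈ Mc.charpoly.roots, μ.re < -r := by
    generalize Mc.charpoly.roots = l at hroots
    induction l using Multiset.induction_on with
    | empty => exact ⟨1, one_pos, by simp⟩
    | cons μ l ih =>
      obtain ⟨r, hr, h⟩ := ih fun ν hν => hroots ν (Multiset.mem_cons_of_mem hν)
      have hμ := hroots μ (Multiset.mem_cons_self μ l)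
      refine ⟨min r (-μ.re / 2), lt_min hr (by linarith), fun ν hν => ?_⟩
      rcases Multiset.mem_cons.1 hν with rfl | hν
      · linarith [min_le_right r (-ν.re / 2)]
      · linarith [min_le_left r (-μ.re / 2), h ν hν]
  set T : (Fin n → ℂ) →L[ℂ] (Fin n → ℂ) :=
    LinearMap.toContinuousLinearMap (Matrix.toLin' Mc) with hT
  obtain ⟨k, hk, h⟩ := exists_decay_of_aeval_prod_eq_zero T r _ hr'
  have hprod : (Mc.charpoly.roots.map fun μ => X - C μ).prod = Mc.charpoly :=
    ((IsAlgClosed.splits _).eq_prod_roots_of_monic (Matrix.charpoly_monic _)).symm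
  have hann : aeval (T : (Fin n → ℂ) →ₗ[ℂ] (Fin n → ℂ)) Mc.charpoly = 0 := by
    have : (T : (Fin n → ℂ) →ₗ[ℂ] (Fin n → ℂ)) = Matrix.toLin' Mc := rfl
    rw [this, ← Matrix.charpoly_toLin', LinearMap.aeval_self_charpoly]
  refine ⟨‖(reVec : (Fin n → ℂ) →L[ℝ] Vec n)‖ * (k * ‖(complexify : Vec n →L[ℝ] _)‖) + 1,
    by positivity, r, hr, expDecayRate_of_solutions (by positivity) fun x hx t ht => ?_⟩
  have h1 := h (fun t => complexify (x t)) (fun t ht => by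
    refine ((hx t ht).map_clm complexify).congr_deriv ?_
    rw [complexify_matCLM]
    simp [hT, hMc]) (fun t _ => by rw [hprod, hann]; rfl) t ht
  calc ‖x t‖ = ‖reVec (complexify (x t))‖ := by rw [reVec_complexify]
    _ ≤ ‖(reVec : (Fin n → ℂ) →L[ℝ] Vec n)‖ * ‖complexify (x t)‖ :=
      ContinuousLinearMap.le_opNorm _ _
    _ ≤ ‖(reVec : (Fin n → ℂ) →L[ℝ] Vec n)‖ *
        (k * (‖(complexify : Vec n →L[ℝ] _)‖ * ‖x 0‖) * Real.exp (-r * t)) := by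
      gcongr
      refine h1.trans ?_
      gcongr
      exact ContinuousLinearMap.le_opNorm _ _
    _ ≤ ‖(reVec : (Fin n → ℂ) →L[ℝ] Vec n)‖ *
        (k * (‖(complexify : Vec n →L[ℝ] _)‖ * ‖x 0‖) * Real.exp (-r * t))
        + ‖x 0‖ * Real.exp (-r * t) := le_add_of_nonneg_right (by positivity)
    _ = _ := by ring

/-- For an eigenvector v with eigenvalue z, the real parts of exp(zt)v and exp(zt)iv are real
solutions, so exp(zt)v decays; if Re z ≥ 0, its entries stay at least as large as those of v. -/
theorem isHurwitz_of_expDecay {M : Matrix (Fin n) (Fin n) ℝ} (h : ExpDecay (matCLM M)) :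
    IsHurwitz M := by
  intro z hz
  obtain ⟨k, hk, ρ, hρ, h⟩ := h
  rw [← Matrix.spectrum_toLin', ← Module.End.hasEigenvalue_iff_mem_spectrum] at hz
  obtain ⟨v, hv⟩ := hz.exists_hasEigenvector
  have hv1 : (M.map (algebraMap ℝ ℂ)).mulVec v = z • v := by simpa using hv.apply_eq_smul
  obtain ⟨i, hi⟩ : ∃ i, v i ≠ 0 := Function.ne_iff.1 hv.2
  by_contra! hz0
  have key : ∀ w : Fin n → ℂ, (M.map (algebraMap ℝ ℂ)).mulVec w = z • w → ∀ t : ℝ, 0 ≤ t →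
      |(Complex.exp (z * t) * w i).re| ≤ k * ‖reVec w‖ * Real.exp (-(ρ / 2) * t) := by
    intro w hw t ht
    have hE : ∀ s : ℝ, HasDerivAt (fun s : ℝ => Complex.exp (z * s))
        (Complex.exp (z * s) * (z * 1)) s := fun s =>
      ((hasDerivAt_id (s : ℂ)).comp_ofReal.const_mul z).cexp
    have := h.norm_le_of_forcing hk.le (half_lt_self hρ) (C := 0) (z := fun _ => 0)
      (y := fun s : ℝ => reVec (Complex.exp (z * s) • w)) (fun s _ => by
        refine (((hE s).smul_const w).hasDerivWithinAt.map_clm reVec).congr_deriv ?_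
        rw [add_zero, ← reVec_mulVec, Matrix.mulVec_smul, hw, smul_smul, mul_one])
      (by simp) t ht
    have h2 := (PiLp.norm_apply_le (reVec (Complex.exp (z * t) • w)) i).trans this
    simpa [reVec_apply] using h2
  have hbound : ∀ t : ℝ, 0 ≤ t → ‖v i‖ ≤
      (k * ‖reVec v‖ + k * ‖reVec (Complex.I • v)‖) * Real.exp (-(ρ / 2) * t) := by
    intro t ht
    have h1 := key v hv1 t ht
    have h2 := key (Complex.I • v) (by rw [Matrix.mulVec_smul, hv1, smul_comm]) t ht
    have h3 := Complex.norm_le_abs_re_add_abs_im (Complex.exp (z * t) * v i)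
    have h4 : |(Complex.exp (z * t) * (Complex.I • v) i).re| =
        |(Complex.exp (z * t) * v i).im| := by
      rw [Pi.smul_apply, smul_eq_mul, mul_left_comm, Complex.I_mul_re, abs_neg]
    have h5 : ‖v i‖ ≤ ‖Complex.exp (z * t) * v i‖ := by
      rw [norm_mul, Complex.norm_exp]
      refine le_mul_of_one_le_left (norm_nonneg _) (Real.one_le_exp ?_)
      simpa using mul_nonneg hz0 ht
    rw [h4] at h2
    linarith
  have hlim : Tendsto (fun t : ℝ =>
      (k * ‖reVec v‖ + k * ‖reVec (Complex.I • v)‖) * Real.exp (-(ρ / 2) * t))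
      atTop (𝓝 0) := by
    have h1 : Tendsto (fun t : ℝ => -(ρ / 2) * t) atTop atBot :=
      tendsto_id.const_mul_atTop_of_neg (by linarith)
    simpa using (Real.tendsto_exp_atBot.comp h1).const_mul
      (k * ‖reVec v‖ + k * ‖reVec (Complex.I • v)‖)
  have := ge_of_tendsto hlim (by
    filter_upwards [eventually_ge_atTop 0] with t ht using hbound t ht)
  exact hi (norm_le_zero_iff.1 this)

end Hurwitz

/-! ### Block triangular systems. -/

section Cascade

variable {E E₁ E₂ : Type*} [NormedAddCommGroup E] [NormedSpace ℝ E] [CompleteSpace E]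
  [NormedAddCommGroup E₁] [NormedSpace ℝ E₁] [CompleteSpace E₁]
  [NormedAddCommGroup E₂] [NormedSpace ℝ E₂] [CompleteSpace E₂]

/-- A block triangular operator with exponentially decaying diagonal blocks decays
exponentially. -/
theorem ExpDecay.cascade {L₁ : E₁ →L[ℝ] E₁} {L₂ : E₂ →L[ℝ] E₂} (h₁ : ExpDecay L₁)
    (h₂ : ExpDecay L₂) {T : E →L[ℝ] E} (P₁ : E →L[ℝ] E₁) (P₂ : E →L[ℝ] E₂) (M : E₁ →L[ℝ] E₂)
    (J : E₁ × E₂ →L[ℝ] E) (hJ : ∀ w, J (P₁ w, P₂ w) = w) (hT₁ : ∀ w, P₁ (T w) = L₁ (P₁ w))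
    (hT₂ : ∀ w, P₂ (T w) = L₂ (P₂ w) + M (P₁ w)) : ExpDecay T := by
  obtain ⟨k₁, hk₁, ρ₁, hρ₁, h₁⟩ := h₁
  obtain ⟨k₂, hk₂, ρ₂, hρ₂, h₂⟩ := h₂
  -- Staying strictly below both rates lets the second block inherit the rate of its forcing.
  obtain ⟨r, hr, hr₁, hr₂⟩ : ∃ r > 0, r < ρ₁ ∧ r < ρ₂ := by
    obtain ⟨r, h⟩ := exists_between (lt_min hρ₁ hρ₂)
    exact ⟨r, h.1, lt_min_iff.1 h.2⟩
  have hd : 0 < ρ₂ - r := sub_pos.2 hr₂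
  set c₁ := k₁ * ‖P₁‖ with hc₁
  set c₂ := k₂ * (‖P₂‖ + ‖M‖ * c₁ / (ρ₂ - r)) with hc₂
  have hc₁0 : 0 ≤ c₁ := by positivity
  have hc₂0 : 0 ≤ c₂ := by positivity
  refine ⟨‖J‖ * (c₁ + c₂) + 1, by positivity, r, hr,
    expDecayRate_of_solutions (by positivity) fun w hw t ht => ?_⟩
  have b₁ : ∀ t, 0 ≤ t → ‖P₁ (w t)‖ ≤ c₁ * ‖w 0‖ * Real.exp (-r * t) := fun t ht => by
    refine (h₁.norm_le_of_forcing hk₁.le hr₁ (z := fun _ => 0) (C := 0)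
      (y := fun t => P₁ (w t)) (fun s hs => ?_) (by simp) t ht).trans ?_
    · rw [add_zero, ← hT₁]
      exact (hw s hs).map_clm P₁
    · rw [zero_div, add_zero, hc₁, mul_assoc k₁ ‖P₁‖]
      gcongr
      exact P₁.le_opNorm _
  have b₂ : ‖P₂ (w t)‖ ≤ c₂ * ‖w 0‖ * Real.exp (-r * t) := by
    refine (h₂.norm_le_of_forcing hk₂.le hr₂ (z := fun t => M (P₁ (w t)))
      (C := ‖M‖ * (c₁ * ‖w 0‖)) (y := fun t => P₂ (w t)) (fun s hs => ?_) (fun s hs => ?_)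
      t ht).trans ?_
    · rw [← hT₂]
      exact (hw s hs).map_clm P₂
    · rw [mul_assoc]
      exact (M.le_opNorm _).trans (by gcongr; exact b₁ s hs)
    · have : c₂ * ‖w 0‖ = k₂ * (‖P₂‖ * ‖w 0‖ + ‖M‖ * (c₁ * ‖w 0‖) / (ρ₂ - r)) := by
        rw [hc₂]; ring
      rw [this]
      gcongr
      exact P₂.le_opNorm _
  calc ‖w t‖ = ‖J (P₁ (w t), P₂ (w t))‖ := by rw [hJ]
    _ ≤ ‖J‖ * (‖P₁ (w t)‖ + ‖P₂ (w t)‖) := by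
      refine (J.le_opNorm _).trans ?_
      gcongr
      exact max_le_add_of_nonneg (norm_nonneg _) (norm_nonneg _)
    _ ≤ ‖J‖ * (c₁ * ‖w 0‖ * Real.exp (-r * t) + c₂ * ‖w 0‖ * Real.exp (-r * t)) := by
      gcongr
      exact b₁ t ht
    _ ≤ ‖J‖ * (c₁ * ‖w 0‖ * Real.exp (-r * t) + c₂ * ‖w 0‖ * Real.exp (-r * t))
        + ‖w 0‖ * Real.exp (-r * t) := le_add_of_nonneg_right (by positivity)
    _ = _ := by ring

end Cascade

/-! ### Matrices as operators and derivatives of the plant terms. -/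

section Plant

variable {n m : ℕ}

theorem matCLM_add {k l : ℕ} (A B : Matrix (Fin k) (Fin l) ℝ) :
    matCLM (A + B) = matCLM A + matCLM B := by
  ext v i
  simp [matCLM_apply, matVec_apply, add_mul, Finset.sum_add_distrib]

theorem matCLM_mul {k l p : ℕ} (A : Matrix (Fin k) (Fin l) ℝ) (B : Matrix (Fin l) (Fin p) ℝ) :
    matCLM (A * B) = (matCLM A).comp (matCLM B) := by
  ext v i
  simp only [matCLM_apply, matVec_apply, ContinuousLinearMap.comp_apply, Matrix.mul_apply,
    Finset.sum_mul, Finset.mul_sum]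
  rw [Finset.sum_comm]
  simp only [mul_assoc]

theorem matCLM_jacobianMatrix {k l : ℕ} (F : Vec l → Vec k) (a : Vec l) :
    matCLM (jacobianMatrix F a) = fderiv ℝ F a := by
  refine ContinuousLinearMap.coe_injective
    ((EuclideanSpace.basisFun (Fin l) ℝ).toBasis.ext fun j => ?_)
  ext i
  simp [matCLM_apply, matVec_apply, jacobianMatrix]

variable {g : Vec n → Matrix (Fin n) (Fin m) ℝ} {D : Type*} [NormedAddCommGroup D]
  [NormedSpace ℝ D]

theorem contDiff_matCLM (hg : ∀ i j, ContDiff ℝ 1 fun x => g x i j) :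
    ContDiff ℝ 1 fun x => matCLM (g x) := by
  refine contDiff_clm_apply_iff.2 fun v => contDiff_euclidean.2 fun i => ?_
  simp only [matCLM_apply, matVec_apply]
  exact ContDiff.sum fun j _ => (hg i j).mul contDiff_const

theorem ContDiff.matVec (hg : ∀ i j, ContDiff ℝ 1 fun x => g x i j) {p : D → Vec n}
    {u : D → Vec m} (hp : ContDiff ℝ 1 p) (hu : ContDiff ℝ 1 u) :
    ContDiff ℝ 1 fun d => matVec (g (p d)) (u d) :=
  ((contDiff_matCLM hg).comp hp).clm_apply hu

/-- Where the control vanishes, only the control contributes to the derivative of `g(p) u`. -/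
theorem HasFDerivAt.matVec_of_eq_zero (hg : ∀ i j, ContDiff ℝ 1 fun x => g x i j) {p : D → Vec n}
    {u : D → Vec m} {d : D} (hp : DifferentiableAt ℝ p d) {u' : D →L[ℝ] Vec m}
    (hu : HasFDerivAt u u' d) (hu0 : u d = 0) :
    HasFDerivAt (fun d => matVec (g (p d)) (u d)) ((matCLM (g (p d))).comp u') d := by
  have h1 : HasFDerivAt (fun d => matCLM (g (p d))) _ d :=
    (((contDiff_matCLM hg).differentiable one_ne_zero (p d)).comp d hp).hasFDerivAt
  have h2 := h1.clm_apply hu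
  rw [hu0, map_zero, add_zero] at h2
  exact h2

/-- Since h is constant along y ↦ (0, y, y), its derivative kills (0, b, b). This is the linear form
of condition (iv). -/
theorem HasFDerivAt.apply_eq_of_diag {A X F : Type*} [NormedAddCommGroup A] [NormedSpace ℝ A]
    [NormedAddCommGroup X] [NormedSpace ℝ X] [NormedAddCommGroup F] [NormedSpace ℝ F]
    {h : A × X × X → F} {Φ : A × X × X →L[ℝ] F} (hΦ : HasFDerivAt h Φ 0)
    (hd : ∀ q y, h (q, y, y) = h (q, 0, 0)) (q : A) (a b : X) :
    Φ (q, a, b) = Φ (q, 0, 0) - Φ (0, b - a, 0) := by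
  set i₁ : X →L[ℝ] A × X × X :=
    (0 : X →L[ℝ] A).prod ((ContinuousLinearMap.id ℝ X).prod (ContinuousLinearMap.id ℝ X))
  have h1 : HasFDerivAt (fun y => h (i₁ y)) (Φ.comp i₁) 0 :=
    HasFDerivAt.comp (0 : X) (by rwa [map_zero]) i₁.hasFDerivAt
  have h2 : HasFDerivAt (fun y => h (i₁ y)) (0 : X →L[ℝ] F) 0 := by
    have : (fun y => h (i₁ y)) = fun _ => h (0, 0, 0) := funext fun y => hd 0 y
    rw [this]
    exact hasFDerivAt_const _ _
  have h3 : Φ (0, b, b) = 0 := DFunLike.congr_fun (h1.unique h2) b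
  have h4 : ((q, a, b) : A × X × X) = (q, 0, 0) + (0, b, b) - (0, b - a, 0) := by simp
  rw [h4, map_sub, map_add, h3, add_zero]

end Plant

/-! ### Sufficiency: the linearized closed loop as a cascade. -/

section Sufficiency

/-- The linearized closed loop decays when observer, Youla parameter and nominal feedback do. -/
theorem expDecay_observer_youla {V U Z : Type*} [NormedAddCommGroup V] [NormedSpace ℝ V]
    [CompleteSpace V] [NormedAddCommGroup U] [NormedSpace ℝ U] [NormedAddCommGroup Z]
    [NormedSpace ℝ Z] [CompleteSpace Z] {A S : V →L[ℝ] V} {B : U →L[ℝ] V} {K : V →L[ℝ] U}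
    {Φ : Z × V × V →L[ℝ] Z} {H : Z × V × V →L[ℝ] U} {T : V × V × Z →L[ℝ] V × V × Z}
    (hT : ∀ x y q, T (x, y, q) = (A x + B (K y + H (q, y, x)),
      A x - S (x - y) + B (K y + H (q, y, x)), Φ (q, y, x)))
    (hS : ExpDecay S) (hΦ : ExpDecay (Φ.comp (ContinuousLinearMap.inl ℝ Z (V × V))))
    (hA : ExpDecay (A + B.comp K))
    (hΦd : ∀ q y x, Φ (q, y, x) = Φ (q, 0, 0) - Φ (0, x - y, 0))
    (hHd : ∀ q y x, H (q, y, x) = H (q, 0, 0) - H (0, x - y, 0)) : ExpDecay T := by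
  set i : Z →L[ℝ] Z × V × V := ContinuousLinearMap.inl ℝ Z (V × V) with hi
  set j : V →L[ℝ] Z × V × V :=
    (ContinuousLinearMap.inr ℝ Z (V × V)).comp (ContinuousLinearMap.inl ℝ V V) with hj
  set e : V × V × Z →L[ℝ] V := ContinuousLinearMap.fst ℝ V (V × Z) -
    (ContinuousLinearMap.fst ℝ V Z).comp (ContinuousLinearMap.snd ℝ V (V × Z)) with he
  set π₁ : V × Z →L[ℝ] V := ContinuousLinearMap.fst ℝ V Z with hπ₁
  set π₂ : V × Z →L[ℝ] Z := ContinuousLinearMap.snd ℝ V Z with hπ₂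
  set ϖ₁ : (V × Z) × V →L[ℝ] V × Z := ContinuousLinearMap.fst ℝ (V × Z) V with hϖ₁
  set ϖ₂ : (V × Z) × V →L[ℝ] V := ContinuousLinearMap.snd ℝ (V × Z) V with hϖ₂
  -- First cascade: the error e = x - x̂ evolves autonomously by `S` and drives q.
  have h₁ : ExpDecay ((S.comp π₁).prod ((Φ.comp i).comp π₂ - (Φ.comp j).comp π₁)) :=
    hS.cascade hΦ π₁ π₂ (-(Φ.comp j)) (ContinuousLinearMap.id ℝ _) (fun _ => rfl)
      (fun _ => rfl) (fun w => by simp [hπ₁, hπ₂, sub_eq_add_neg])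
  -- Second cascade: (e, q) drives x, because x̂ = x - e turns Ax + BKx̂ into (A + BK)x - BKe.
  refine h₁.cascade hA (e.prod (π₂.comp (ContinuousLinearMap.snd ℝ V (V × Z))))
    (ContinuousLinearMap.fst ℝ V (V × Z))
    (B.comp ((H.comp i).comp π₂ - (H.comp j + K).comp π₁))
    (ϖ₂.prod ((ϖ₂ - π₁.comp ϖ₁).prod (π₂.comp ϖ₁))) ?_ ?_ ?_
  · rintro ⟨x, y, q⟩
    simp [he, hπ₁, hπ₂, hϖ₁, hϖ₂]
  · rintro ⟨x, y, q⟩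
    rw [ContinuousLinearMap.prod_apply, hT]
    refine Prod.ext ?_ (hΦd q y x)
    change A x + B (K y + H (q, y, x)) - (A x - S (x - y) + B (K y + H (q, y, x))) = S (x - y)
    abel
  · rintro ⟨x, y, q⟩
    rw [hT]
    change A x + B (K y + H (q, y, x)) =
      A x + B (K x) + B (H (q, 0, 0) - (H (0, x - y, 0) + K (x - y)))
    rw [hHd q y x]
    simp only [map_add, map_sub]
    abel

variable {n m : ℕ} {f : Vec n → Vec n} {g : Vec n → Matrix (Fin n) (Fin m) ℝ}

theorem ContDiff.closedLoop {Z : Type} [NormedAddCommGroup Z] [NormedSpace ℝ Z]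
    (hf : ContDiff ℝ 1 f) (hg : ∀ i j, ContDiff ℝ 1 fun x => g x i j) {P : Policy n m Z}
    (hdyn : ContDiff ℝ 1 fun w : Vec n × Z => P.dyn w.2 w.1)
    (hout : ContDiff ℝ 1 fun w : Vec n × Z => P.out w.2 w.1) :
    ContDiff ℝ 1 (closedLoop f g P) :=
  ((hf.comp contDiff_fst).add (ContDiff.matVec hg contDiff_fst hout)).prodMk hdyn

namespace YoulaPolicy

variable {nq : ℕ} (Q : YoulaPolicy n m nq)

theorem contDiff_control :
    ContDiff ℝ 1 fun w : Vec n × Vec n × Vec nq => Q.control w.2 w.1 :=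
  ((matCLM Q.K).contDiff.comp (contDiff_fst.comp contDiff_snd)).add
    (Q.contDiff_hq.comp (by fun_prop))

theorem contDiff_closedLoop (hf : ContDiff ℝ 1 f)
    (hg : ∀ i j, ContDiff ℝ 1 fun x => g x i j) (hs : ContDiff ℝ 1 Q.s) :
    ContDiff ℝ 1 (closedLoop f g (Q.toPolicy f g)) := by
  refine ContDiff.closedLoop hf hg (ContDiff.prodMk (ContDiff.add ?_ ?_) ?_) Q.contDiff_control
  · exact (hf.comp contDiff_fst).sub (hs.comp (by fun_prop))
  · exact ContDiff.matVec hg contDiff_fst Q.contDiff_control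
  · exact Q.contDiff_fq.comp (by fun_prop)

theorem control_zero (hq : Q.hq (0, 0, 0) = 0) : Q.control (0, 0) 0 = 0 := by
  simp [control, hq, ← matCLM_apply]

theorem closedLoop_zero (hf0 : f 0 = 0) (hs : Q.s 0 = 0) (hq : Q.hq (0, 0, 0) = 0)
    (hfq : Q.fq (0, 0, 0) = 0) : closedLoop f g (Q.toPolicy f g) (0, 0, 0) = 0 := by
  simp [closedLoop, toPolicy, Q.control_zero hq, hf0, hs, hfq, ← matCLM_apply]

/-- The linearization of the closed loop at the origin. -/
theorem exists_hasFDerivAt_closedLoop (hf : ContDiff ℝ 1 f)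
    (hg : ∀ i j, ContDiff ℝ 1 fun x => g x i j) (hq : Q.hq (0, 0, 0) = 0)
    {S : Vec n →L[ℝ] Vec n} (hS : HasFDerivAt Q.s S 0)
    {Φ : Vec nq × Vec n × Vec n →L[ℝ] Vec nq} (hΦ : HasFDerivAt Q.fq Φ (0, 0, 0))
    {H : Vec nq × Vec n × Vec n →L[ℝ] Vec m} (hH : HasFDerivAt Q.hq H (0, 0, 0)) :
    ∃ T : Vec n × Vec n × Vec nq →L[ℝ] Vec n × Vec n × Vec nq,
      HasFDerivAt (closedLoop f g (Q.toPolicy f g)) T (0, 0, 0) ∧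
      ∀ x y q, T (x, y, q) =
        (fderiv ℝ f 0 x + matCLM (g 0) (matCLM Q.K y + H (q, y, x)),
          fderiv ℝ f 0 x - S (x - y) + matCLM (g 0) (matCLM Q.K y + H (q, y, x)),
          Φ (q, y, x)) := by
  have dX : HasFDerivAt (fun w : Vec n × Vec n × Vec nq => w.1)
      (ContinuousLinearMap.fst ℝ _ _) (0, 0, 0) := hasFDerivAt_fst
  have dV : HasFDerivAt (fun w : Vec n × Vec n × Vec nq => w.2)
      (ContinuousLinearMap.snd ℝ _ _) (0, 0, 0) := hasFDerivAt_snd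
  have dY : HasFDerivAt (fun w : Vec n × Vec n × Vec nq => w.2.1) _ (0, 0, 0) := dV.fst
  have dZ : HasFDerivAt (fun w : Vec n × Vec n × Vec nq => w.2.2) _ (0, 0, 0) := dV.snd
  have dι := dZ.prodMk (dY.prodMk dX)
  have dA : HasFDerivAt (fun w : Vec n × Vec n × Vec nq => f w.1) _ (0, 0, 0) :=
    HasFDerivAt.comp (g := f) _ (hf.differentiable one_ne_zero 0).hasFDerivAt dX
  have dS : HasFDerivAt (fun w : Vec n × Vec n × Vec nq => Q.s (w.1 - w.2.1)) _ (0, 0, 0) :=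
    HasFDerivAt.comp (g := Q.s) _ (by simpa using hS) (dX.sub dY)
  have dΦ : HasFDerivAt (fun w : Vec n × Vec n × Vec nq => Q.fq (w.2.2, w.2.1, w.1)) _ (0, 0, 0) :=
    HasFDerivAt.comp (g := Q.fq) _ hΦ dι
  have dU : HasFDerivAt (fun w : Vec n × Vec n × Vec nq => Q.control w.2 w.1) _ (0, 0, 0) :=
    (HasFDerivAt.comp (g := matCLM Q.K) _ (matCLM Q.K).hasFDerivAt dY).add
      (HasFDerivAt.comp (g := Q.hq) _ hH dι)
  have dG := HasFDerivAt.matVec_of_eq_zero hg (p := fun w : Vec n × Vec n × Vec nq => w.1)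
    differentiableAt_fst dU (Q.control_zero hq)
  exact ⟨_, (dA.add dG).prodMk (((dA.sub dS).add dG).prodMk dΦ), fun _ _ _ => rfl⟩

theorem Admissible.locallyExpStable {Q : YoulaPolicy n m nq}
    (hQ : Q.Admissible f g) (hf : ContDiff ℝ 1 f)
    (hg : ∀ i j, ContDiff ℝ 1 fun x => g x i j) (hf0 : f 0 = 0) :
    LocallyExpStable (closedLoop f g (Q.toPolicy f g)) := by
  have dS := (hQ.contDiff_s.differentiable one_ne_zero 0).hasFDerivAt
  have dΦ := (Q.contDiff_fq.differentiable one_ne_zero (0, 0, 0)).hasFDerivAt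
  have dH := (Q.contDiff_hq.differentiable one_ne_zero (0, 0, 0)).hasFDerivAt
  obtain ⟨T, hT, hTe⟩ := Q.exists_hasFDerivAt_closedLoop hf hg hQ.hq_zero dS dΦ dH
  have hA : ExpDecay (fderiv ℝ f 0 + (matCLM (g 0)).comp (matCLM Q.K)) := by
    have := hQ.hurwitz.expDecay
    rwa [matCLM_add, matCLM_mul, matCLM_jacobianMatrix] at this
  exact locallyExpStable_of_expDecay (Q.contDiff_closedLoop hf hg hQ.contDiff_s)
    (Q.closedLoop_zero hf0 hQ.stable_s.map_zero hQ.hq_zero hQ.stable_fq.map_zero) hT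
    (expDecay_observer_youla hTe (hQ.stable_s.expDecay dS)
      (hQ.stable_fq.expDecay (HasFDerivAt.comp (g := Q.fq) (0 : Vec nq) dΦ
        (ContinuousLinearMap.inl ℝ (Vec nq) (Vec n × Vec n)).hasFDerivAt)) hA
      (dΦ.apply_eq_of_diag hQ.fq_diag) (dH.apply_eq_of_diag hQ.hq_diag))

end YoulaPolicy

end Sufficiency

/-! ### Necessity: emulating a given controller. -/

section Necessity

variable {n m : ℕ} {f : Vec n → Vec n} {g : Vec n → Matrix (Fin n) (Fin m) ℝ}

/-- Local exponential stability is invariant under linear changes of coordinates. -/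
theorem LocallyExpStable.conj {E E' : Type*} [NormedAddCommGroup E] [NormedSpace ℝ E]
    [NormedAddCommGroup E'] [NormedSpace ℝ E'] {F : E → E} (h : LocallyExpStable F)
    (Ψ : E' ≃L[ℝ] E) : LocallyExpStable fun q => Ψ.symm (F (Ψ q)) := by
  obtain ⟨c, hc, k, hk, r, hr, h⟩ := h
  set a := ‖(Ψ : E' →L[ℝ] E)‖
  set b := ‖(Ψ.symm : E →L[ℝ] E')‖
  have hΨ : ∀ q, ‖Ψ q‖ ≤ a * ‖q‖ := (Ψ : E' →L[ℝ] E).le_opNorm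
  -- The added ones keep the constants positive when the spaces are trivial and `a = b = 0`.
  refine ⟨c / (a + 1), by positivity, b * (k * a) + 1, by positivity, r, hr, fun q₀ hq₀ => ?_⟩
  have hx₀ : ‖Ψ q₀‖ < c := by
    rw [lt_div_iff₀ (by positivity)] at hq₀
    linarith [hΨ q₀, norm_nonneg q₀]
  obtain ⟨⟨x, hx0, hx⟩, hb⟩ := h _ hx₀
  refine ⟨⟨fun t => Ψ.symm (x t), by simp [hx0], fun t ht => ?_⟩, fun q hq0 hq t ht => ?_⟩
  · simpa using (hx t ht).map_clm (Ψ.symm : E →L[ℝ] E')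
  · have h1 := hb (fun t => Ψ (q t)) (by rw [hq0])
      (fun t ht => by simpa using (hq t ht).map_clm (Ψ : E' →L[ℝ] E)) t ht
    calc ‖q t‖ = ‖(Ψ.symm : E →L[ℝ] E') (Ψ (q t))‖ := by simp
      _ ≤ b * ‖Ψ (q t)‖ := ContinuousLinearMap.le_opNorm _ _
      _ ≤ b * (k * (a * ‖q₀‖) * Real.exp (-r * t)) := by
        gcongr
        exact h1.trans (by gcongr; exact hΨ q₀)
      _ ≤ b * (k * (a * ‖q₀‖) * Real.exp (-r * t)) + ‖q₀‖ * Real.exp (-r * t) :=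
        le_add_of_nonneg_right (by positivity)
      _ = _ := by ring

/-- A solution of `δ' = N(p, δ)` starting at `0` stays at `0` when `N(p, 0) = 0`. -/
theorem eq_zero_of_hasDerivWithinAt {P E : Type*} [NormedAddCommGroup P] [NormedSpace ℝ P]
    [FiniteDimensional ℝ P] [NormedAddCommGroup E] [NormedSpace ℝ E] [FiniteDimensional ℝ E]
    {N : P × E → E} (hN : ContDiff ℝ 1 N) (hN0 : ∀ p, N (p, 0) = 0) {J : Set ℝ}
    (hJ : J.OrdConnected) (h0 : (0 : ℝ) ∈ J) {p : ℝ → P} (hp : ContinuousOn p J) {δ : ℝ → E}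
    (hδ : ∀ t ∈ J, HasDerivWithinAt δ (N (p t, δ t)) J t) (hδ0 : δ 0 = 0) {T : ℝ} (hT : T ∈ J)
    (hT0 : 0 ≤ T) : δ T = 0 := by
  have hsub : Icc 0 T ⊆ J := hJ.out h0 hT
  have hδc : ContinuousOn δ (Icc 0 T) := fun t ht =>
    (hδ t (hsub ht)).continuousWithinAt.mono hsub
  obtain ⟨M, hM⟩ := isCompact_Icc.exists_bound_of_continuousOn ((hp.mono hsub).prodMk hδc)
  obtain ⟨K, hK⟩ := hN.exists_lipschitzOnWith_closedBall M
  refine eq_zero_of_abs_deriv_le_mul_abs_self_of_eq_zero_right (K := K)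
    (f' := fun t => N (p t, δ t)) hδc (fun t ht => ?_) hδ0
    (fun t ht => ?_) T ⟨hT0, le_rfl⟩
  · exact ((hδ t (hsub ⟨ht.1, ht.2.le⟩)).mono hsub).mono_of_mem_nhdsWithin
      (mem_of_superset (Icc_mem_nhdsGE ht.2) (Icc_subset_Icc_left ht.1))
  · have hb := hM t ⟨ht.1, ht.2.le⟩
    have h1 := hK.norm_sub_le (x := (p t, δ t)) (y := (p t, 0)) (by simpa using hb)
      (by simpa using (le_max_left _ _).trans hb)
    simpa [hN0] using h1

namespace DynController

variable {nc : ℕ}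

/-- The observer-plus-Youla policy that emulates a dynamic controller `C`: the state `q` holds a
copy `ξ` of the observer state together with the controller state, in the coordinates `Ψ`, and
the plant state is read as `x - x̂ + ξ`. -/
noncomputable def toYoula (C : DynController n m nc) (f : Vec n → Vec n)
    (g : Vec n → Matrix (Fin n) (Fin m) ℝ) (hf : ContDiff ℝ 1 f)
    (hg : ∀ i j, ContDiff ℝ 1 fun x => g x i j) (S : Vec n →L[ℝ] Vec n)
    (K : Matrix (Fin m) (Fin n) ℝ) {nq : ℕ} (Ψ : Vec nq ≃L[ℝ] Vec n × Vec nc) :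
    YoulaPolicy n m nq where
  s := S
  K := K
  -- Subtracting S(x - x̂) gives ξ the observer's own correction, so ξ and x̂ obey the same equation
  -- once they agree; the term -Kξ in `hq` then cancels Kx̂.
  fq a := Ψ.symm (closedLoop f g C.toPolicy (a.2.2 - a.2.1 + (Ψ a.1).1, (Ψ a.1).2)
    - (S (a.2.2 - a.2.1), 0))
  hq a := C.hc ((Ψ a.1).2, a.2.2 - a.2.1 + (Ψ a.1).1) - matVec K (Ψ a.1).1
  contDiff_fq := by
    have h := ContDiff.closedLoop hf hg (P := C.toPolicy)
      (C.contDiff_fc.comp (contDiff_snd.prodMk contDiff_fst))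
      (C.contDiff_hc.comp (contDiff_snd.prodMk contDiff_fst))
    refine Ψ.symm.contDiff.comp ((h.comp ?_).sub ?_) <;> fun_prop
  contDiff_hq :=
    (C.contDiff_hc.comp (by fun_prop)).sub ((matCLM K).contDiff.comp (by fun_prop))

variable {C : DynController n m nc} {hf : ContDiff ℝ 1 f}
  {hg : ∀ i j, ContDiff ℝ 1 fun x => g x i j} {S : Vec n →L[ℝ] Vec n}
  {K : Matrix (Fin m) (Fin n) ℝ} {nq : ℕ} {Ψ : Vec nq ≃L[ℝ] Vec n × Vec nc}

theorem toYoula_control (y : Vec n) (q : Vec nq) (x : Vec n) :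
    (C.toYoula f g hf hg S K Ψ).control (y, q) x =
      matVec K y + (C.hc ((Ψ q).2, x - y + (Ψ q).1) - matVec K (Ψ q).1) := rfl

theorem toYoula_control_of_eq {y : Vec n} {q : Vec nq} (h : (Ψ q).1 = y) (x : Vec n) :
    (C.toYoula f g hf hg S K Ψ).control (y, q) x = C.hc ((Ψ q).2, x) := by
  rw [toYoula_control, h, sub_add_cancel, add_sub_cancel]

theorem toYoula_dyn (y : Vec n) (q : Vec nq) (x : Vec n) :
    ((C.toYoula f g hf hg S K Ψ).toPolicy f g).dyn (y, q) x =
      (f x - S (x - y) + matVec (g x) ((C.toYoula f g hf hg S K Ψ).control (y, q) x),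
        Ψ.symm (closedLoop f g C.toPolicy (x - y + (Ψ q).1, (Ψ q).2) - (S (x - y), 0))) := rfl

theorem toYoula_admissible (hC : LocallyExpStable (closedLoop f g C.toPolicy))
    (hK : IsHurwitz (jacobianMatrix f 0 + g 0 * K)) (hS : ExpDecay S) :
    (C.toYoula f g hf hg S K Ψ).Admissible f g where
  hurwitz := hK
  contDiff_s := S.contDiff
  stable_s := locallyExpStable_of_expDecay S.contDiff (map_zero S) S.hasFDerivAt hS
  stable_fq := by
    convert hC.conj Ψ using 2 with q
    simp [toYoula]
  fq_diag q y := by simp [toYoula]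
  hq_diag q y := by simp [toYoula]
  hq_zero := by simp [toYoula, C.hc_zero, ← matCLM_apply]

/-- Along a run of C, the observer equation is linear in x̂ with continuous forcing, because s is
linear; hence x̂ exists on all of `J`, and ξ is taken equal to it. -/
theorem isResponse_toYoula {z₀ : Vec nc} {J : Set ℝ} (hJ : J.OrdConnected) (h0 : (0 : ℝ) ∈ J)
    (hJ0 : J ⊆ Ici 0) {x : ℝ → Vec n} (hx : ContinuousOn x J) {u : ℝ → Vec m}
    (h : IsResponse C.toPolicy z₀ J x u) :
    IsResponse ((C.toYoula f g hf hg S K Ψ).toPolicy f g) (0, Ψ.symm (0, z₀)) J x u := by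
  obtain ⟨z, hz0, hz⟩ := h
  have hzc : ContinuousOn z J := fun t ht => (hz t ht).1.continuousWithinAt
  have hφ : ContinuousOn
      (fun t => f (x t) - S (x t) + matVec (g (x t)) (C.hc (z t, x t))) J :=
    ((hf.continuous.comp_continuousOn hx).sub (S.continuous.comp_continuousOn hx)).add
      (((contDiff_matCLM hg).continuous.comp_continuousOn hx).clm_apply
        (C.contDiff_hc.continuous.comp_continuousOn (hzc.prodMk hx)))
  obtain ⟨y, hy0, hy⟩ := exists_forced_linear_solution S hJ h0 hJ0 hφ 0
  refine ⟨fun t => (y t, Ψ.symm (y t, z t)), by simp only [hy0, hz0], fun t ht => ⟨?_, ?_⟩⟩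
  · rw [toYoula_dyn, toYoula_control_of_eq (by simp)]
    have hyt : HasDerivWithinAt y (f (x t) - S (x t - y t) + matVec (g (x t)) (C.hc (z t, x t)))
        J t := by
      refine (hy t ht).congr_deriv ?_
      rw [map_sub]; abel
    have hq := (hyt.prodMk (hz t ht).1).map_clm (Ψ.symm : Vec n × Vec nc →L[ℝ] Vec nq)
    refine (hyt.prodMk hq).congr_deriv ?_
    simp only [ContinuousLinearEquiv.apply_symm_apply, sub_add_cancel]
    refine Prod.ext rfl (congrArg Ψ.symm (Prod.ext ?_ ?_))
    · change f (x t) - S (x t - y t) + matVec (g (x t)) (C.hc (z t, x t)) =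
        f (x t) + matVec (g (x t)) (C.hc (z t, x t)) - S (x t - y t)
      abel
    · exact (sub_zero _).symm
  · refine (hz t ht).2.trans ?_
    change _ = (C.toYoula f g hf hg S K Ψ).control (y t, Ψ.symm (y t, z t)) (x t)
    rw [toYoula_control_of_eq (by simp)]
    simp [toPolicy]

/-- The mismatch δ = ξ - x̂ starts at 0 and obeys an equation for which 0 is an equilibrium, so the
policy reads the true state and z is a run of C. -/
theorem isResponse_of_toYoula {z₀ : Vec nc} {J : Set ℝ} (hJ : J.OrdConnected) (h0 : (0 : ℝ) ∈ J)
    (hJ0 : J ⊆ Ici 0) {x : ℝ → Vec n} (hx : ContinuousOn x J) {u : ℝ → Vec m}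
    (h : IsResponse ((C.toYoula f g hf hg S K Ψ).toPolicy f g) (0, Ψ.symm (0, z₀)) J x u) :
    IsResponse C.toPolicy z₀ J x u := by
  obtain ⟨w, hw0, hw⟩ := h
  set y : ℝ → Vec n := fun t => (w t).1 with hy
  set ξ : ℝ → Vec n := fun t => (Ψ (w t).2).1 with hξ
  set z : ℝ → Vec nc := fun t => (Ψ (w t).2).2 with hz
  have hwd := fun t ht => (hw t ht).1
  have hyd : ∀ t ∈ J, HasDerivWithinAt y (f (x t) - S (x t - y t) + matVec (g (x t))
      (matVec K (y t) + (C.hc (z t, x t - y t + ξ t) - matVec K (ξ t)))) J t := fun t ht =>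
    (hwd t ht).map_clm (ContinuousLinearMap.fst ℝ (Vec n) (Vec nq))
  have hΨd : ∀ t ∈ J, HasDerivWithinAt (fun t => Ψ (w t).2)
      (closedLoop f g C.toPolicy (x t - y t + ξ t, z t) - (S (x t - y t), 0)) J t :=
    fun t ht => by
      have := (hwd t ht).map_clm
        ((Ψ : _ →L[ℝ] Vec n × Vec nc).comp (ContinuousLinearMap.snd ℝ (Vec n) (Vec nq)))
      refine this.congr_deriv ?_
      exact Ψ.apply_symm_apply _
  have hξd : ∀ t ∈ J, HasDerivWithinAt ξ (f (x t - y t + ξ t) + matVec (g (x t - y t + ξ t))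
      (C.hc (z t, x t - y t + ξ t)) - S (x t - y t)) J t := fun t ht =>
    (hΨd t ht).map_clm (ContinuousLinearMap.fst ℝ (Vec n) (Vec nc))
  have hzd : ∀ t ∈ J, HasDerivWithinAt z (C.fc (z t, x t - y t + ξ t)) J t := fun t ht => by
    refine ((hΨd t ht).map_clm (ContinuousLinearMap.snd ℝ (Vec n) (Vec nc))).congr_deriv ?_
    exact sub_zero _
  have hzc : ContinuousOn z J := fun t ht => (hzd t ht).continuousWithinAt
  -- The field ξ' - x̂' as a function of ((z, x), δ), with reading x + δ; the two S(x - x̂) terms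
  -- have cancelled.
  let N : (Vec nc × Vec n) × Vec n → Vec n := fun a =>
    f (a.1.2 + a.2) - f a.1.2 + matVec (g (a.1.2 + a.2)) (C.hc (a.1.1, a.1.2 + a.2))
      - matVec (g a.1.2) (C.hc (a.1.1, a.1.2 + a.2) - matVec K a.2)
  have hN : ContDiff ℝ 1 N := by
    have hh : ContDiff ℝ 1 fun a : (Vec nc × Vec n) × Vec n => C.hc (a.1.1, a.1.2 + a.2) :=
      C.contDiff_hc.comp (by fun_prop)
    exact ((((hf.comp (by fun_prop)).sub (hf.comp (by fun_prop))).add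
      (ContDiff.matVec hg (by fun_prop) hh))).sub (ContDiff.matVec hg (by fun_prop)
        (hh.sub ((matCLM K).contDiff.comp (by fun_prop))))
  have hδ : ∀ t ∈ J, ξ t = y t := fun t ht => by
    refine sub_eq_zero.1 (eq_zero_of_hasDerivWithinAt (δ := fun t => ξ t - y t)
      (p := fun t => (z t, x t)) hN (fun p => by simp [N, ← matCLM_apply]) hJ h0
      (hzc.prodMk hx) (fun t ht => ?_) (by simp [hξ, hy, hw0]) ht (hJ0 ht))
    refine ((hξd t ht).sub (hyd t ht)).congr_deriv ?_
    have : x t - y t + ξ t = x t + (ξ t - y t) := by abel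
    simp only [N, this]
    simp only [← matCLM_apply, map_add, map_sub]
    abel
  refine ⟨z, by simp [hz, hw0], fun t ht => ⟨?_, ?_⟩⟩
  · have := hzd t ht
    rwa [hδ t ht, sub_add_cancel] at this
  · exact (hw t ht).2.trans (toYoula_control_of_eq (hδ t ht) (x t))

end DynController

end Necessity

theorem theorem1 {n m : ℕ} (f : Vec n → Vec n) (g : Vec n → Matrix (Fin n) (Fin m) ℝ)
    (hf : ContDiff ℝ 1 f) (hg : ∀ i j, ContDiff ℝ 1 fun x => g x i j) (hf0 : f 0 = 0)
    (hstab : ExpStabilizable f g) :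
    (∀ (nq : ℕ) (Q : YoulaPolicy n m nq), Q.Admissible f g →
      LocallyExpStable (closedLoop f g (Q.toPolicy f g))) ∧
    (∀ (nc : ℕ) (C : DynController n m nc), LocallyExpStable (closedLoop f g C.toPolicy) →
      ∃ (nq : ℕ) (Q : YoulaPolicy n m nq), Q.Admissible f g ∧
        RewritesAs C.toPolicy (Q.toPolicy f g)) := by
  refine ⟨fun nq Q hQ => hQ.locallyExpStable hf hg hf0, fun nc C hC => ?_⟩
  obtain ⟨κ, hκ, hκ0, hstab⟩ := hstab
  -- This matrix is used twice: as A + BK in condition (i), and as the linear observer field s in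
  -- condition (ii).
  have hdecay : ExpDecay (matCLM (jacobianMatrix f 0 + g 0 * jacobianMatrix κ 0)) := by
    rw [matCLM_add, matCLM_mul, matCLM_jacobianMatrix, matCLM_jacobianMatrix]
    exact hstab.expDecay ((hf.differentiable one_ne_zero 0).hasFDerivAt.add
      (HasFDerivAt.matVec_of_eq_zero hg differentiableAt_id
        (hκ.differentiable one_ne_zero 0).hasFDerivAt hκ0))
  let Ψ : Vec (n + nc) ≃L[ℝ] Vec n × Vec nc := EuclideanSpace.finAddEquivProd
  exact ⟨n + nc, C.toYoula f g hf hg _ (jacobianMatrix κ 0) Ψ,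
    DynController.toYoula_admissible hC (isHurwitz_of_expDecay hdecay) hdecay,
    fun z₀ => ⟨(0, Ψ.symm (0, z₀)), fun J hJ h0 hJ0 x hx u =>
      ⟨DynController.isResponse_toYoula hJ h0 hJ0 hx,
        DynController.isResponse_of_toYoula hJ h0 hJ0 hx⟩⟩⟩
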